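/- Let $d\ge 1$. For $V:\mathbb Z^d\to\mathbb R$ let $H$ be the discrete Schrödinger operator on $\ell_2(\mathbb Z^d)$, $$(Hf)(x)=\sum_{i=1}^d \big(f(x+e_i)+f(x-e_i)\big)+V(x)f(x),$$ with domain $\{f\in\ell_2(\mathbb Z^d): Hf\in\ell_2(\mathbb Z^d)\}$ (all of $\ell_2(\mathbb Z^d)$ if $V$ is bounded). Throughout, $\|x\|=\max_i|x_i|$. For a finite $s\subset\mathbb Z^d$ let $H_s=P_sHP_s^*$ be the restriction of $H$ to $\ell_2(s)$, and for $E\in\mathbb R$ let $G_E[H_s]=(H_s-E)^{-1}$; if $E$ is an eigenvalue of $H_s$ we put $\|G_E[H_s]\|=\infty$. A box is a product of $d$ finite integer intervals. An $L$-rectangle is a box with one side of $L+1$ points and $d-1$ sides of $2L+1$ points. The inner boundary $\partial_{\rm in}s$ is the set of points of $s$ with a nearest neighbour outside $s$. Fix $m>0$, $b\in(0,1)$ and an integer $J\ge1$. * An $L$-rectangle $R$ is $E$-regular if $E$ is not an eigenvalue of $H_R$ and $|G_E[H_R](x,y)|\le e^{-m(L+L^b)}$ for all $x,y\in\partial_{\rm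 in}R$ with $\|x-y\|\ge L$; otherwise it is $E$-singular. * A finite set $B$ is $(E,L)$-resonant if there is $s\subset B$ of the form $s=B_1\setminus B_2$, with $B_1,B_2$ boxes, such that $\|G_E[H_s]\|>\exp\big(\tfrac{mL^b}{16J}\big)$. * A collection of non-empty sets is $n$-sparse in $B$ if it does not contain $n$ pairwise disjoint sets that are subsets of $B$. **Proposition.** For any $d\ge1$, $m>0$, $b\in(0,1)$, $\gamma\in(2-b,\infty)$ and integer $J\ge1$ there exists $L_*=L_*(m,b,\gamma,J,d)$ such that the following holds for every integer $L_0\ge L_*$ and every $V:\mathbb Z^d\to\mathbb R$. Let $L_{k+1}=\lfloor L_k^\gamma\rfloor$ for $k\ge0$, and assume that for every $E\in\mathbb R$ 1. for every $k\ge0$, the $(E,L_k)$-resonant $L_{k+1}$-rectangles are $J$-sparse in any $L_{k+2}$-rectangle, and $2$-sparse in the box $[-L_{k+2},L_{k+2}]^d$; 2. the $E$-singular $L_0$-rectangles are $J$-sparse in any $L_1$-rectangle. Then (a) the spectrum of $H$ is pure point, i.e. the eigenfunctions of $H$ span a dense subspace of $\ell_2(\mathbb Z^d)$; (b) every eigenfunction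 $\psi$ of $H$ satisfies $\sup_{x\in\mathbb Z^d}|\psi(x)|\exp\big(\tfrac m{16}\|x\|\big)<\infty$. -/

import Mathlib

noncomputable section

namespace MSA

/-- The lattice `ℤ^d`. The Mathlib norm on it is the sup norm. -/
abbrev Lattice (d : ℕ) : Type := Fin d → ℤ

/-- The Hilbert space `ℓ₂(ℤ^d)` of complex square-summable functions. -/
abbrev Ell2 (d : ℕ) : Type := lp (fun _ : Lattice d => ℂ) 2

/-- The formal action `f ↦ (x ↦ ∑_{y ∼ x} f y + V x * f x)` on all functions on `ℤ^d`, the sum being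
over the `2 d` nearest neighbours `x ± e_i` of `x`. -/
def formalSchrodinger {d : ℕ} (V : Lattice d → ℝ) : (Lattice d → ℂ) →ₗ[ℂ] (Lattice d → ℂ) where
  toFun f x := ∑ i : Fin d, (f (x + Pi.single i 1) + f (x - Pi.single i 1)) + (V x : ℂ) * f x
  map_add' f g := by
    funext x
    simp only [Pi.add_apply, Finset.sum_add_distrib]
    ring
  map_smul' c f := by
    funext x
    simp only [Pi.smul_apply, smul_eq_mul, RingHom.id_apply, Finset.sum_add_distrib, mul_add,
      Finset.mul_sum]
    ring

/-- The discrete Schrödinger operator with potential `V` on `ℓ₂(ℤ^d)`, with its self-adjoint domain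
`{f ∈ ℓ₂ : H f ∈ ℓ₂}` (all of `ℓ₂` if `V` is bounded). -/
def schrodinger {d : ℕ} (V : Lattice d → ℝ) : Ell2 d →ₗ.[ℂ] Ell2 d where
  domain :=
    { carrier := {f | Memℓp (formalSchrodinger V (f : Lattice d → ℂ)) 2}
      add_mem' := by
        intro f g hf hg
        have h := Memℓp.add hf hg
        rw [← map_add] at h
        exact h
      zero_mem' := by
        change Memℓp (formalSchrodinger V (0 : Lattice d → ℂ)) 2
        rw [map_zero]
        exact zero_memℓp
      smul_mem' := by
        intro c f hf
        have h := Memℓp.const_smul hf c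
        rw [← map_smul] at h
        exact h }
  toFun :=
    { toFun := fun f => ⟨formalSchrodinger V ((f : Ell2 d) : Lattice d → ℂ), f.2⟩
      map_add' := fun f g => Subtype.ext
        (map_add (formalSchrodinger V) ((f : Ell2 d) : Lattice d → ℂ) ((g : Ell2 d) : Lattice d → ℂ))
      map_smul' := fun c f => Subtype.ext
        (map_smul (formalSchrodinger V) c ((f : Ell2 d) : Lattice d → ℂ)) }

/-- `ψ ∈ ℓ₂(ℤ^d)` is an eigenfunction of the partially defined operator `T`. -/
def IsEigenfunction {d : ℕ} (T : Ell2 d →ₗ.[ℂ] Ell2 d) (ψ : Ell2 d) : Prop :=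
  ψ ≠ 0 ∧ ∃ E : ℂ, ∃ h : ψ ∈ T.domain, T ⟨ψ, h⟩ = E • ψ

/-- Pure point spectrum: the eigenfunctions span a dense subspace, that is, the pure point subspace
is all of `ℓ₂(ℤ^d)`. -/
def HasPurePointSpectrum {d : ℕ} (T : Ell2 d →ₗ.[ℂ] Ell2 d) : Prop :=
  (Submodule.span ℂ {ψ : Ell2 d | IsEigenfunction T ψ}).topologicalClosure = ⊤

/-- The restriction `H_s = P_s H P_s^*` to a finite set `s`, as the matrix
`(x, y) ↦ (H δ_y)(x)`, `x, y ∈ s`. -/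
def restriction {d : ℕ} (V : Lattice d → ℝ) (s : Finset (Lattice d)) : Matrix s s ℂ :=
  Matrix.of fun x y => formalSchrodinger V (Pi.single (y : Lattice d) 1) (x : Lattice d)

/-- `E` is not an eigenvalue of `H_s`, so that the resolvent `(H_s - E)⁻¹` exists. -/
def HasResolvent {d : ℕ} (V : Lattice d → ℝ) (E : ℝ) (s : Finset (Lattice d)) : Prop :=
  IsUnit (restriction V s - (E : ℂ) • (1 : Matrix s s ℂ))

/-- The resolvent `G_E[H_s] = (H_s - E)⁻¹` (meaningful under `HasResolvent`). -/
def green {d : ℕ} (V : Lattice d → ℝ) (E : ℝ) (s : Finset (Lattice d)) : Matrix s s ℂ :=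
  (restriction V s - (E : ℂ) • (1 : Matrix s s ℂ))⁻¹

/-- Boxes: products of `d` (finite, possibly empty) integer intervals. -/
def IsBox {d : ℕ} (B : Finset (Lattice d)) : Prop :=
  ∃ a c : Lattice d, B = Finset.Icc a c

/-- Differences of two boxes. -/
def IsBoxDiff {d : ℕ} (s : Finset (Lattice d)) : Prop :=
  ∃ B₁ B₂ : Finset (Lattice d), IsBox B₁ ∧ IsBox B₂ ∧ s = B₁ \ B₂

/-- `L`-rectangles: boxes with one side of `L + 1` points and `d - 1` sides of `2 L + 1` points. -/
def IsRectangle {d : ℕ} (L : ℕ) (R : Finset (Lattice d)) : Prop :=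
  ∃ (a : Lattice d) (i : Fin d),
    R = Finset.Icc a (fun j => a j + if j = i then (L : ℤ) else 2 * (L : ℤ))

/-- The inner boundary: points of `s` with a nearest neighbour outside `s`. -/
def innerBoundary {d : ℕ} (s : Finset (Lattice d)) : Set (Lattice d) :=
  {u | u ∈ s ∧ ∃ i : Fin d, u + Pi.single i 1 ∉ s ∨ u - Pi.single i 1 ∉ s}

/-- `E`-regularity (with mass `m` and exponent `b`) of an `L`-rectangle `R`. -/
def IsRegular {d : ℕ} (V : Lattice d → ℝ) (m b : ℝ) (E : ℝ) (L : ℕ)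
    (R : Finset (Lattice d)) : Prop :=
  HasResolvent V E R ∧
    ∀ x y : R, (x : Lattice d) ∈ innerBoundary R → (y : Lattice d) ∈ innerBoundary R →
      (L : ℝ) ≤ ‖(x : Lattice d) - (y : Lattice d)‖ →
        ‖green V E R x y‖ ≤ Real.exp (-m * ((L : ℝ) + (L : ℝ) ^ b))

/-- `(E, L)`-resonance of a finite set `B`: some difference of boxes `s ⊆ B` has
`‖G_E[H_s]‖ > exp (m L^b / (16 J))` in the `ℓ₂` operator norm, which counts as infinite when `E` is
an eigenvalue of `H_s`. -/
def IsResonant {d : ℕ} (V : Lattice d → ℝ) (m b : ℝ) (J : ℕ) (E : ℝ) (L : ℕ)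
    (B : Finset (Lattice d)) : Prop :=
  ∃ s : Finset (Lattice d), IsBoxDiff s ∧ s ⊆ B ∧
    (¬ HasResolvent V E s ∨
      Real.exp (m * (L : ℝ) ^ b / (16 * (J : ℝ))) <
        ‖Matrix.toEuclideanCLM (n := s) (𝕜 := ℂ) (green V E s)‖)

/-- A collection `S` of finite sets is `J`-sparse in `B` if there are no `J` pairwise disjoint
members of `S` contained in `B`. -/
def IsSparse {d : ℕ} (J : ℕ) (S : Set (Finset (Lattice d))) (B : Finset (Lattice d)) : Prop :=
  ¬ ∃ R : Fin J → Finset (Lattice d),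
    (∀ j, R j ∈ S ∧ R j ⊆ B) ∧ ∀ i j, i ≠ j → Disjoint (R i) (R j)

/-- The `(E, L)`-resonant `L'`-rectangles. -/
def resonantRectangles {d : ℕ} (V : Lattice d → ℝ) (m b : ℝ) (J : ℕ) (E : ℝ) (L L' : ℕ) :
    Set (Finset (Lattice d)) :=
  {R | IsRectangle L' R ∧ IsResonant V m b J E L R}

/-- The `E`-singular `L`-rectangles. -/
def singularRectangles {d : ℕ} (V : Lattice d → ℝ) (m b : ℝ) (E : ℝ) (L : ℕ) :
    Set (Finset (Lattice d)) :=
  {R | IsRectangle L R ∧ ¬ IsRegular V m b E L R}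

/-- The box `[-L, L]^d`. -/
def centredBox (d : ℕ) (L : ℕ) : Finset (Lattice d) :=
  Finset.Icc (fun _ => -(L : ℤ)) (fun _ => (L : ℤ))

/-- The scales `L_0`, `L_{k+1} = ⌊L_k^γ⌋`. -/
def scale (γ : ℝ) (L₀ : ℕ) : ℕ → ℕ
  | 0 => L₀
  | k + 1 => ⌊(scale γ L₀ k : ℝ) ^ γ⌋₊

end MSA

end

/-!
If a box contains few singular `L`-rectangles and no resonances, its Green kernel decays: cut the
box into slabs orthogonal to one direction and move towards the source through flush regular
`L`-rectangles, each of which gains `exp (-m (L + L ^ b))`; the factor `exp (-m L ^ b)` absorbs the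
resolvent bounds of the slabs. By `J`-sparsity only boundedly many coordinate intervals of length
`O(L)` have to be jumped over. Hence nonresonant rectangles are regular at the next scale, and
induction over the scales makes the singular rectangles sparse at all of them.

A solution of `H f = E f` is small inside a nonresonant box. If the central box of some scale is
resonant, then by `2`-sparsity the rectangles away from it are not, and a solution decays
exponentially in the surrounding annulus. For an eigenfunction this happens at all large scales,
since otherwise it would vanish.

For completeness, expand `δ_x` in the eigenfunctions of a growing box. Those for which the central
box of some scale `k ≥ K` is nonresonant carry little weight at `x`; the others decay at a rate and
with constants that do not depend on the box, so their limits are eigenfunctions of `H`. Therefore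
a vector orthogonal to all eigenfunctions of `H` vanishes.
-/

namespace MSA

noncomputable section

open Filter Topology ComplexConjugate
open scoped Matrix

variable {d : ℕ}

/-! ### Resolvent kernels of finite restrictions -/

lemma formalSchrodinger_apply (V : Lattice d → ℝ) (f : Lattice d → ℂ) (x : Lattice d) :
    formalSchrodinger V f x =
      ∑ i : Fin d, (f (x + Pi.single i 1) + f (x - Pi.single i 1)) + (V x : ℂ) * f x := rfl

lemma star_formalSchrodinger (V : Lattice d → ℝ) (f : Lattice d → ℂ) :
    star (formalSchrodinger V f) = formalSchrodinger V (star f) := by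
  funext x
  simp [formalSchrodinger_apply]

lemma formalSchrodinger_single_comm (V : Lattice d → ℝ) (x y : Lattice d) :
    formalSchrodinger V (Pi.single y 1) x = formalSchrodinger V (Pi.single x 1) y := by
  have hadd (i : Fin d) : y + Pi.single i 1 = x ↔ x - Pi.single i 1 = y := by
    rw [sub_eq_iff_eq_add, eq_comm]
  have hsub (i : Fin d) : y - Pi.single i 1 = x ↔ x + Pi.single i 1 = y := by
    rw [sub_eq_iff_eq_add, eq_comm]
  simp only [formalSchrodinger_apply, Pi.single_apply, hadd, hsub, add_comm]
  by_cases hxy : x = y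
  · simp [hxy]
  · simp [hxy, Ne.symm hxy]

lemma restriction_isSymm (V : Lattice d → ℝ) (s : Finset (Lattice d)) :
    (restriction V s).IsSymm :=
  Matrix.IsSymm.ext fun x y => formalSchrodinger_single_comm V y x

lemma restriction_isHermitian (V : Lattice d → ℝ) (s : Finset (Lattice d)) :
    (restriction V s).IsHermitian := by
  refine Matrix.IsHermitian.ext fun x y => ?_
  calc star (formalSchrodinger V (Pi.single (x : Lattice d) 1) y)
      = formalSchrodinger V (star (Pi.single (x : Lattice d) 1)) y := by
        rw [← star_formalSchrodinger, Pi.star_apply]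
    _ = formalSchrodinger V (Pi.single (y : Lattice d) 1) x := by
        rw [← Pi.single_star, star_one, formalSchrodinger_single_comm]

lemma restriction_mulVec (V : Lattice d → ℝ) (s : Finset (Lattice d)) (f : Lattice d → ℂ) (x : s) :
    (restriction V s *ᵥ fun y : s => f y) x =
      formalSchrodinger V ((s : Set (Lattice d)).indicator f) x := by
  have hsum : (s : Set (Lattice d)).indicator f =
      ∑ y ∈ s, f y • (Pi.single y (1 : ℂ) : Lattice d → ℂ) := by
    funext w
    simp [Finset.sum_apply, Pi.single_apply, Set.indicator_apply]
  rw [hsum, map_sum, Finset.sum_apply, ← Finset.sum_coe_sort]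
  simp [Matrix.mulVec, dotProduct, restriction, mul_comm]

lemma restriction_sub_smul_mulVec (V : Lattice d → ℝ) (E : ℂ) (s : Finset (Lattice d))
    (f : Lattice d → ℂ) (x : s) :
    ((restriction V s - E • (1 : Matrix s s ℂ)) *ᵥ fun y : s => f y) x =
      formalSchrodinger V ((s : Set (Lattice d)).indicator f) x - E * f x := by
  simp [Matrix.sub_mulVec, Matrix.smul_mulVec, restriction_mulVec]

lemma HasResolvent.mul_green {V : Lattice d → ℝ} {E : ℝ} {s : Finset (Lattice d)}
    (hs : HasResolvent V E s) :
    (restriction V s - (E : ℂ) • (1 : Matrix s s ℂ)) * green V E s = 1 :=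
  Matrix.mul_nonsing_inv _ ((Matrix.isUnit_iff_isUnit_det _).1 hs)

lemma HasResolvent.green_mul {V : Lattice d → ℝ} {E : ℝ} {s : Finset (Lattice d)}
    (hs : HasResolvent V E s) :
    green V E s * (restriction V s - (E : ℂ) • (1 : Matrix s s ℂ)) = 1 :=
  Matrix.nonsing_inv_mul _ ((Matrix.isUnit_iff_isUnit_det _).1 hs)

lemma green_isSymm (V : Lattice d → ℝ) (E : ℝ) (s : Finset (Lattice d)) :
    (green V E s).IsSymm := by
  simp [Matrix.IsSymm, green, Matrix.transpose_nonsing_inv, (restriction_isSymm V s).eq]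

/-- The resolvent kernel of `H_s`, extended by zero to `ℤ^d × ℤ^d`, so that kernels of different
sets `s` can be compared. -/
def greenKernel (V : Lattice d → ℝ) (E : ℝ) (s : Finset (Lattice d)) (x z : Lattice d) : ℂ :=
  if h : x ∈ s ∧ z ∈ s then green V E s ⟨x, h.1⟩ ⟨z, h.2⟩ else 0

lemma greenKernel_coe (V : Lattice d → ℝ) (E : ℝ) {s : Finset (Lattice d)} (x z : s) :
    greenKernel V E s x z = green V E s x z := by
  simp [greenKernel]

lemma greenKernel_of_notMem_left (V : Lattice d → ℝ) (E : ℝ) {s : Finset (Lattice d)}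
    {x : Lattice d} (z : Lattice d) (hx : x ∉ s) : greenKernel V E s x z = 0 := by
  simp [greenKernel, hx]

lemma greenKernel_comm (V : Lattice d → ℝ) (E : ℝ) (s : Finset (Lattice d)) (x z : Lattice d) :
    greenKernel V E s x z = greenKernel V E s z x := by
  unfold greenKernel
  by_cases h : x ∈ s ∧ z ∈ s
  · rw [dif_pos h, dif_pos h.symm, (green_isSymm V E s).apply]
  · rw [dif_neg h, dif_neg (mt And.symm h)]

lemma indicator_greenKernel (V : Lattice d → ℝ) (E : ℝ) (s : Finset (Lattice d)) (z : Lattice d) :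
    (s : Set (Lattice d)).indicator (fun y => greenKernel V E s y z) =
      fun y => greenKernel V E s y z :=
  Set.indicator_eq_self.2 fun _ hy => by
    contrapose! hy
    simpa using greenKernel_of_notMem_left V E z hy

lemma formalSchrodinger_greenKernel (V : Lattice d → ℝ) {E : ℝ} {s : Finset (Lattice d)}
    (hs : HasResolvent V E s) {x z : Lattice d} (hx : x ∈ s) (hz : z ∈ s) :
    formalSchrodinger V (fun y => greenKernel V E s y z) x =
      E * greenKernel V E s x z + if x = z then 1 else 0 := by
  have hmul : ((restriction V s - (E : ℂ) • (1 : Matrix s s ℂ)) *ᵥ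
      fun y : s => greenKernel V E s y z) ⟨x, hx⟩ = if x = z then 1 else 0 := by
    have hentry := congrFun (congrFun hs.mul_green ⟨x, hx⟩) ⟨z, hz⟩
    simp only [Matrix.mul_apply, Matrix.one_apply, Subtype.mk.injEq] at hentry
    rw [← hentry]
    exact Finset.sum_congr rfl fun y _ => by rw [← greenKernel_coe V E y ⟨z, hz⟩]
  rw [restriction_sub_smul_mulVec V E s fun y => greenKernel V E s y z,
    indicator_greenKernel] at hmul
  rw [← hmul]
  ring

lemma eq_neg_sum_greenKernel_mul (V : Lattice d → ℝ) {E : ℝ} {s : Finset (Lattice d)}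
    (hs : HasResolvent V E s) {f : Lattice d → ℂ}
    (hf : ∀ y ∈ s, formalSchrodinger V f y = E * f y) {x : Lattice d} (hx : x ∈ s) :
    f x = -∑ y ∈ s, greenKernel V E s x y *
      formalSchrodinger V ((s : Set (Lattice d))ᶜ.indicator f) y := by
  have hmul (y : s) : ((restriction V s - (E : ℂ) • (1 : Matrix s s ℂ)) *ᵥ fun y : s => f y) y =
      -formalSchrodinger V ((s : Set (Lattice d))ᶜ.indicator f) y := by
    have hsplit : formalSchrodinger V f =
        formalSchrodinger V ((s : Set (Lattice d)).indicator f) +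
          formalSchrodinger V ((s : Set (Lattice d))ᶜ.indicator f) := by
      rw [← map_add, Set.indicator_self_add_compl]
    rw [restriction_sub_smul_mulVec, ← hf y y.2, hsplit]
    simp
  have hinv : green V E s *ᵥ ((restriction V s - (E : ℂ) • (1 : Matrix s s ℂ)) *ᵥ
      fun y : s => f y) = fun y : s => f y := by
    rw [Matrix.mulVec_mulVec, hs.green_mul, Matrix.one_mulVec]
  calc f x = ∑ y : s, green V E s ⟨x, hx⟩ y *
        ((restriction V s - (E : ℂ) • (1 : Matrix s s ℂ)) *ᵥ fun y : s => f y) y :=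
        (congrFun hinv ⟨x, hx⟩).symm
    _ = ∑ y : s, -(greenKernel V E s x y *
          formalSchrodinger V ((s : Set (Lattice d))ᶜ.indicator f) y) :=
        Finset.sum_congr rfl fun y _ => by rw [hmul y, ← greenKernel_coe, mul_neg]
    _ = _ := by
        rw [Finset.sum_neg_distrib, Finset.sum_coe_sort s fun y => greenKernel V E s x y *
          formalSchrodinger V ((s : Set (Lattice d))ᶜ.indicator f) y]

/-- `y'` is a nearest neighbour of `y` in direction `j`; the direction is recorded because a box is
left through the face orthogonal to it. -/
def IsNeighbour (j : Fin d) (y y' : Lattice d) : Prop :=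
  y' = y + Pi.single j 1 ∨ y' = y - Pi.single j 1

lemma norm_formalSchrodinger_indicator_compl_le (V : Lattice d → ℝ) {s : Finset (Lattice d)}
    {f : Lattice d → ℂ} {y : Lattice d} (hy : y ∈ s) {C : ℝ} (hC0 : 0 ≤ C)
    (hC : ∀ j y', IsNeighbour j y y' → y' ∉ s → ‖f y'‖ ≤ C) :
    ‖formalSchrodinger V ((s : Set (Lattice d))ᶜ.indicator f) y‖ ≤ 2 * d * C := by
  have hnb (j : Fin d) (y' : Lattice d) (hn : IsNeighbour j y y') :
      ‖(s : Set (Lattice d))ᶜ.indicator f y'‖ ≤ C := by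
    by_cases h : y' ∈ s
    · simpa [h] using hC0
    · simpa [h] using hC j y' hn h
  have hzero : (s : Set (Lattice d))ᶜ.indicator f y = 0 := by simp [hy]
  rw [formalSchrodinger_apply, hzero, mul_zero, add_zero]
  calc _ ≤ ∑ _j : Fin d, (C + C) := norm_sum_le_of_le _ fun j _ =>
        norm_add_le_of_le (hnb j _ (Or.inl rfl)) (hnb j _ (Or.inr rfl))
    _ = 2 * d * C := by
        simp only [Finset.sum_const, Finset.card_univ, Fintype.card_fin, nsmul_eq_mul]
        ring

lemma norm_le_of_greenKernel_mul_le (V : Lattice d → ℝ) {E : ℝ} {s : Finset (Lattice d)}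
    (hs : HasResolvent V E s) {f : Lattice d → ℂ}
    (hf : ∀ y ∈ s, formalSchrodinger V f y = E * f y) {x : Lattice d} (hx : x ∈ s) {C : ℝ}
    (hC0 : 0 ≤ C)
    (hC : ∀ y ∈ s, ∀ j y', IsNeighbour j y y' → y' ∉ s → ‖greenKernel V E s x y‖ * ‖f y'‖ ≤ C) :
    ‖f x‖ ≤ 2 * d * s.card * C := by
  have hterm (y : Lattice d) (hy : y ∈ s) : ‖greenKernel V E s x y *
      formalSchrodinger V ((s : Set (Lattice d))ᶜ.indicator f) y‖ ≤ 2 * d * C := by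
    have hsmul : greenKernel V E s x y • (s : Set (Lattice d))ᶜ.indicator f =
        (s : Set (Lattice d))ᶜ.indicator (greenKernel V E s x y • f) :=
      (Set.indicator_const_smul (s : Set (Lattice d))ᶜ (greenKernel V E s x y) f).symm
    rw [← smul_eq_mul, ← Pi.smul_apply, ← map_smul, hsmul]
    exact norm_formalSchrodinger_indicator_compl_le V hy hC0 fun j y' hn hy' => by
      simpa using hC y hy j y' hn hy'
  rw [eq_neg_sum_greenKernel_mul V hs hf hx, norm_neg]
  calc _ ≤ ∑ _y ∈ s, 2 * d * C := norm_sum_le_of_le s hterm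
    _ = 2 * d * s.card * C := by
        simp only [Finset.sum_const, nsmul_eq_mul]
        ring

lemma norm_greenKernel_le_of_ssubset (V : Lattice d → ℝ) {E : ℝ} {s s' : Finset (Lattice d)}
    (hs : HasResolvent V E s) (hs' : HasResolvent V E s') (hss' : s' ⊆ s) {v z : Lattice d}
    (hv : v ∈ s \ s') (hz : z ∈ s') {η C : ℝ} (hη : ∀ x y, ‖greenKernel V E s x y‖ ≤ η)
    (hC0 : 0 ≤ C)
    (hC : ∀ y ∈ s', ∀ j y', IsNeighbour j y y' → y' ∈ s \ s' → ‖greenKernel V E s' y z‖ ≤ C) :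
    ‖greenKernel V E s v z‖ ≤ 2 * d * s'.card * (C * η) := by
  have hη0 : 0 ≤ η := (norm_nonneg _).trans (hη v z)
  obtain ⟨hvs, hvs'⟩ := Finset.mem_sdiff.1 hv
  rw [greenKernel_comm]
  refine norm_le_of_greenKernel_mul_le V (f := fun y => greenKernel V E s y v) hs' (fun y hy => ?_)
    hz (by positivity) fun y hy j y' hn hy' => ?_
  · have hyv : y ≠ v := fun h => hvs' (h ▸ hy)
    rw [formalSchrodinger_greenKernel V hs (hss' hy) hvs, if_neg hyv, add_zero]
  · by_cases hy's : y' ∈ s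
    · rw [greenKernel_comm V E s' z y]
      exact mul_le_mul (hC y hy j y' hn (Finset.mem_sdiff.2 ⟨hy's, hy'⟩)) (hη _ _) (norm_nonneg _)
        hC0
    · rw [greenKernel_of_notMem_left V E v hy's, norm_zero, mul_zero]
      positivity

lemma norm_apply_le_norm_toEuclideanCLM {ι 𝕜 : Type*} [Fintype ι] [DecidableEq ι] [RCLike 𝕜]
    (A : Matrix ι ι 𝕜) (i j : ι) :
    ‖A i j‖ ≤ ‖Matrix.toEuclideanCLM (n := ι) (𝕜 := 𝕜) A‖ := by
  have hentry : A i j =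
      Matrix.toEuclideanCLM (n := ι) (𝕜 := 𝕜) A (EuclideanSpace.single j 1) i := by
    simp [Matrix.ofLp_toEuclideanCLM]
  calc ‖A i j‖ ≤ ‖Matrix.toEuclideanCLM (n := ι) (𝕜 := 𝕜) A (EuclideanSpace.single j 1)‖ :=
        hentry ▸ PiLp.norm_apply_le _ _
    _ ≤ ‖Matrix.toEuclideanCLM (n := ι) (𝕜 := 𝕜) A‖ := by
        simpa using
          (Matrix.toEuclideanCLM (n := ι) (𝕜 := 𝕜) A).le_opNorm (EuclideanSpace.single j 1)

lemma norm_greenKernel_le (V : Lattice d → ℝ) (E : ℝ) (s : Finset (Lattice d)) (x z : Lattice d) :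
    ‖greenKernel V E s x z‖ ≤ ‖Matrix.toEuclideanCLM (n := s) (𝕜 := ℂ) (green V E s)‖ := by
  unfold greenKernel
  split_ifs with h
  · exact norm_apply_le_norm_toEuclideanCLM _ _ _
  · simp

lemma IsBox.isBoxDiff (hd : 1 ≤ d) {B : Finset (Lattice d)} (hB : IsBox B) : IsBoxDiff B := by
  have hempty : IsBox (∅ : Finset (Lattice d)) :=
    ⟨1, 0, (Finset.Icc_eq_empty fun h : (1 : Lattice d) ≤ 0 =>
      absurd (h ⟨0, hd⟩) (by simp)).symm⟩
  exact ⟨B, ∅, hB, hempty, Finset.sdiff_empty.symm⟩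

lemma IsResonant.mono {V : Lattice d → ℝ} {m b : ℝ} {J : ℕ} {E : ℝ} {L : ℕ}
    {B B' : Finset (Lattice d)} (h : IsResonant V m b J E L B) (hB : B ⊆ B') :
    IsResonant V m b J E L B' := by
  obtain ⟨s, hs, hsB, hres⟩ := h
  exact ⟨s, hs, hsB.trans hB, hres⟩

/-- The bound `exp (m L^b / (16 J))` on the resolvents of box differences in a non-resonant set. -/
def resBound (m b : ℝ) (J L : ℕ) : ℝ := Real.exp (m * (L : ℝ) ^ b / (16 * (J : ℝ)))

lemma one_le_resBound {m : ℝ} (hm : 0 ≤ m) (b : ℝ) (J L : ℕ) : 1 ≤ resBound m b J L :=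
  Real.one_le_exp (by positivity)

lemma IsBox.resolvent_of_not_isResonant (hd : 1 ≤ d) {V : Lattice d → ℝ} {m b : ℝ} {J : ℕ} {E : ℝ}
    {L : ℕ} {B s : Finset (Lattice d)} (hs : IsBox s) (hres : ¬ IsResonant V m b J E L B)
    (hsB : s ⊆ B) :
    HasResolvent V E s ∧ ∀ x z, ‖greenKernel V E s x z‖ ≤ resBound m b J L := by
  unfold IsResonant at hres
  push Not at hres
  obtain ⟨hs', hnorm⟩ := hres s (hs.isBoxDiff hd) hsB
  exact ⟨hs', fun x z => (norm_greenKernel_le V E s x z).trans hnorm⟩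

section Recursion

open scoped Classical in
/-- The number of integers in `[t, e]` outside the exceptional intervals `[p j, p j + W]`. -/
def freeCount {ι : Type*} (p : ι → ℤ) (W : ℕ) (t e : ℤ) : ℕ :=
  ((Finset.Icc t e).filter fun s => ∀ j, s ∉ Set.Icc (p j) (p j + W)).card

/-- The number of exceptional intervals `[p j, p j + W]` that do not end before `t`. -/
def obstacleCount {ι : Type*} [Fintype ι] (p : ι → ℤ) (W : ℕ) (t : ℤ) : ℕ :=
  (Finset.univ.filter fun j => t ≤ p j + W).card

variable {ι : Type*} {p : ι → ℤ} {W : ℕ}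

lemma freeCount_of_lt {t e : ℤ} (h : e < t) : freeCount p W t e = 0 := by
  simp [freeCount, Finset.Icc_eq_empty_of_lt h]

lemma freeCount_le_add {t t' e : ℤ} {D : ℕ} (h : t' ≤ t + D) :
    freeCount p W t e ≤ freeCount p W t' e + D := by
  classical
  have hsub : (Finset.Icc t e).filter (fun s => ∀ j, s ∉ Set.Icc (p j) (p j + W)) ⊆
      (Finset.Icc t' e).filter (fun s => ∀ j, s ∉ Set.Icc (p j) (p j + W)) ∪
        Finset.Ico t (t + D) := by
    intro s hs
    simp only [Finset.mem_union, Finset.mem_filter, Finset.mem_Icc, Finset.mem_Ico] at hs ⊢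
    by_cases hst : s < t + D
    · exact Or.inr ⟨hs.1.1, hst⟩
    · exact Or.inl ⟨⟨by omega, hs.1.2⟩, hs.2⟩
  have hcard := (Finset.card_le_card hsub).trans (Finset.card_union_le _ _)
  rw [Int.card_Ico, add_sub_cancel_left, Int.toNat_natCast] at hcard
  unfold freeCount
  convert hcard

lemma freeCount_le_of_mem_Icc {t t' e : ℤ} {j : ι} (ht : p j ≤ t) (ht' : t' ≤ p j + W + 1) :
    freeCount p W t e ≤ freeCount p W t' e := by
  classical
  refine Finset.card_le_card fun s hs => ?_
  simp only [Finset.mem_filter, Finset.mem_Icc] at hs ⊢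
  have hj := hs.2 j
  rw [Set.mem_Icc] at hj
  exact ⟨⟨by omega, hs.1.2⟩, hs.2⟩

variable [Fintype ι]

lemma obstacleCount_anti {t t' : ℤ} (h : t ≤ t') : obstacleCount p W t' ≤ obstacleCount p W t :=
  Finset.card_le_card fun _ hj => by
    simp only [Finset.mem_filter, Finset.mem_univ, true_and] at hj ⊢
    omega

lemma obstacleCount_lt {t : ℤ} {j : ι} (h : t ≤ p j + W) :
    obstacleCount p W (p j + W + 1) < obstacleCount p W t := by
  refine Finset.card_lt_card (Finset.ssubset_iff_of_subset (fun j' hj' => ?_) |>.2 ⟨j, ?_, ?_⟩)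
  · simp only [Finset.mem_filter, Finset.mem_univ, true_and] at hj' ⊢
    omega
  · simpa using h
  · simp

lemma le_freeCount_add (t e : ℤ) :
    e + 1 - t ≤ freeCount p W t e + Fintype.card ι * (W + 1) := by
  classical
  have hcover : Finset.Icc t e ⊆
      (Finset.Icc t e).filter (fun s => ∀ j, s ∉ Set.Icc (p j) (p j + W)) ∪
        Finset.univ.biUnion fun j => Finset.Icc (p j) (p j + W) := by
    intro s hs
    by_cases h : ∀ j, s ∉ Set.Icc (p j) (p j + W)
    · exact Finset.mem_union_left _ (Finset.mem_filter.2 ⟨hs, h⟩)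
    · refine Finset.mem_union_right _ ?_
      simpa only [Finset.mem_biUnion, Finset.mem_univ, true_and, Finset.mem_Icc, Set.mem_Icc,
        not_forall, not_not] using h
  have hunion : (Finset.univ.biUnion fun j => Finset.Icc (p j) (p j + W)).card ≤
      Fintype.card ι * (W + 1) := by
    refine Finset.card_biUnion_le_card_mul _ _ _ fun j _ => ?_
    rw [Int.card_Icc]
    omega
  have hcard := (Finset.card_le_card hcover).trans (Finset.card_union_le _ _)
  rw [Int.card_Icc] at hcard
  have hfree : (e + 1 - t).toNat ≤ freeCount p W t e + Fintype.card ι * (W + 1) := by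
    refine (hcard.trans (Nat.add_le_add_left hunion _)).trans_eq ?_
    unfold freeCount
    congr
  have hcast : ((e + 1 - t).toNat : ℤ) ≤ freeCount p W t e + Fintype.card ι * (W + 1) := by
    exact_mod_cast hfree
  omega

variable {D : ℕ} {z t₀ : ℤ} {S : ℤ → Set ℝ} {η Q α : ℝ}

lemma mul_freeCount_bound_le_of_mem_Icc (hη : 0 ≤ η) (hQ : 1 ≤ Q) (hα : 0 ≤ α) {t e : ℤ} {j : ι}
    (hj : t ∈ Set.Icc (p j) (p j + W)) :
    Q * (η * Q ^ obstacleCount p W (p j + W + 1) *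
        Real.exp (-(α * freeCount p W (p j + W + 1) e))) ≤
      η * Q ^ obstacleCount p W t * Real.exp (-(α * freeCount p W t e)) := by
  have hcount : freeCount p W t e ≤ freeCount p W (p j + W + 1) e :=
    freeCount_le_of_mem_Icc hj.1 le_rfl
  calc Q * (η * Q ^ obstacleCount p W (p j + W + 1) *
        Real.exp (-(α * freeCount p W (p j + W + 1) e)))
      = η * Q ^ (obstacleCount p W (p j + W + 1) + 1) *
        Real.exp (-(α * freeCount p W (p j + W + 1) e)) := by ring
    _ ≤ _ := by
      gcongr
      exact obstacleCount_lt hj.2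

lemma freeCount_bound_of_recursion (hη : 0 ≤ η) (hQ : 1 ≤ Q) (hα : 0 ≤ α)
    (htriv : ∀ t, t₀ ≤ t → η ∈ upperBounds (S t))
    (hjump : ∀ t t' C, 0 ≤ C → t₀ ≤ t → t < t' → t' ≤ z → C ∈ upperBounds (S t') →
      Q * C ∈ upperBounds (S t))
    (hgood : ∀ t C, 0 ≤ C → t₀ ≤ t → t + D ≤ z → (∀ j, t ∉ Set.Icc (p j) (p j + W)) →
      (∀ t', t < t' → t' ≤ t + D → C ∈ upperBounds (S t')) →
        Real.exp (-(α * D)) * C ∈ upperBounds (S t))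
    {t : ℤ} (ht₀ : t₀ ≤ t) :
    η * Q ^ obstacleCount p W t * Real.exp (-(α * freeCount p W t (z - D))) ∈
      upperBounds (S t) := by
  have : 0 ≤ Q := zero_le_one.trans hQ
  induction hk : (z - t).toNat using Nat.strong_induction_on generalizing t with
  | _ k ih =>
  rcases Nat.eq_zero_or_pos (freeCount p W t (z - D)) with hzero | hpos
  · refine upperBounds_mono_mem ?_ (htriv t ht₀)
    rw [hzero]
    simpa using le_mul_of_one_le_right hη (one_le_pow₀ hQ)
  have hle : t + D ≤ z := by
    by_contra hlt
    exact hpos.ne' (freeCount_of_lt (by omega))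
  by_cases hfree : ∀ j, t ∉ Set.Icc (p j) (p j + W)
  · have hstep := hgood t (η * Q ^ obstacleCount p W t *
      Real.exp (-(α * freeCount p W t (z - D)) + α * D)) (by positivity) ht₀ hle hfree ?_
    · rwa [mul_left_comm, ← Real.exp_add, neg_add_cancel_comm_assoc] at hstep
    · intro t' htt' ht'
      refine upperBounds_mono_mem ?_ (ih _ (by omega) (ht₀.trans htt'.le) rfl)
      have hcount : (freeCount p W t (z - D) : ℝ) ≤ freeCount p W t' (z - D) + D := by
        exact_mod_cast freeCount_le_add ht'
      have hexp : -(α * freeCount p W t' (z - D)) ≤ -(α * freeCount p W t (z - D)) + α * D := by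
        linarith [mul_le_mul_of_nonneg_left hcount hα]
      gcongr
      exact obstacleCount_anti htt'.le
  · obtain ⟨j, hj⟩ := not_forall_not.1 hfree
    have hjz : p j + W + 1 ≤ z := by
      by_contra hlt
      have hfew := freeCount_le_of_mem_Icc (W := W) (e := z - D) hj.1
        (t' := z - D + 1) (by omega)
      rw [freeCount_of_lt (lt_add_one _)] at hfew
      omega
    have hlt : t < p j + W + 1 := Int.lt_add_one_of_le hj.2
    refine upperBounds_mono_mem ?_ (hjump t _ _ (by positivity) ht₀ hlt hjz
      (ih _ (by omega) (ht₀.trans hlt.le) rfl))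
    exact mul_freeCount_bound_le_of_mem_Icc hη hQ hα hj

-- An exceptional interval is crossed in a single jump: it costs one factor `Q`, and the decay over
-- its `W + 1` integers is lost.
lemma exp_bound_of_recursion (p : ι → ℤ) (W : ℕ) (hη : 0 ≤ η) (hQ : 1 ≤ Q) (hα : 0 ≤ α)
    (htriv : ∀ t, t₀ ≤ t → η ∈ upperBounds (S t))
    (hjump : ∀ t t' C, 0 ≤ C → t₀ ≤ t → t < t' → t' ≤ z → C ∈ upperBounds (S t') →
      Q * C ∈ upperBounds (S t))
    (hgood : ∀ t C, 0 ≤ C → t₀ ≤ t → t + D ≤ z → (∀ j, t ∉ Set.Icc (p j) (p j + W)) →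
      (∀ t', t < t' → t' ≤ t + D → C ∈ upperBounds (S t')) →
        Real.exp (-(α * D)) * C ∈ upperBounds (S t))
    {t : ℤ} (ht₀ : t₀ ≤ t) :
    η * Q ^ Fintype.card ι * Real.exp (-(α * ((z : ℝ) - t - D - Fintype.card ι * (W + 1)))) ∈
      upperBounds (S t) := by
  refine upperBounds_mono_mem ?_
    (freeCount_bound_of_recursion (p := p) (W := W) hη hQ hα htriv hjump hgood ht₀)
  have : 0 ≤ Q := zero_le_one.trans hQ
  have hcount : (z : ℝ) - D + 1 - t ≤ freeCount p W t (z - D) + Fintype.card ι * (W + 1) := by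
    exact_mod_cast le_freeCount_add (p := p) (W := W) t (z - D)
  gcongr
  · exact Finset.card_le_univ _
  · linarith

end Recursion

lemma IsSparse.mono {J : ℕ} {S S' : Set (Finset (Lattice d))} {B B' : Finset (Lattice d)}
    (h : IsSparse J S B) (hS : S' ⊆ S) (hB : B' ⊆ B) : IsSparse J S' B' := by
  rintro ⟨R, hR, hdisj⟩
  exact h ⟨R, fun j => ⟨hS (hR j).1, (hR j).2.trans hB⟩, hdisj⟩

lemma IsSparse.exists_blocking_family {J : ℕ} {S : Set (Finset (Lattice d))}
    {B : Finset (Lattice d)} (h : IsSparse J S B) :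
    ∃ n < J, ∃ R : Fin n → Finset (Lattice d), (∀ j, R j ∈ S) ∧
      ∀ R' ∈ S, R' ⊆ B → ∃ j, ¬ Disjoint R' (R j) := by
  induction J with
  | zero => exact absurd ⟨Fin.elim0, fun j => j.elim0, fun j => j.elim0⟩ h
  | succ J ih =>
    by_cases hJ : IsSparse J S B
    · obtain ⟨n, hn, hR⟩ := ih hJ
      exact ⟨n, by omega, hR⟩
    · obtain ⟨R, hR, hdisj⟩ := not_not.1 hJ
      refine ⟨J, by omega, R, fun j => (hR j).1, fun R' hR' hR'B => ?_⟩
      by_contra! hcon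
      refine h ⟨Fin.cons R' R, Fin.cases ⟨hR', hR'B⟩ hR, fun i j hij => ?_⟩
      cases i using Fin.cases <;> cases j using Fin.cases
      · exact absurd rfl hij
      · exact hcon _
      · exact (hcon _).symm
      · exact hdisj _ _ fun h => hij (congrArg Fin.succ h)

/-! ### Decay of the resolvent kernel through slabs -/

lemma mem_box {a c w : Lattice d} : w ∈ Finset.Icc a c ↔ ∀ j, a j ≤ w j ∧ w j ≤ c j := by
  simp only [Finset.mem_Icc, Pi.le_def, forall_and]

lemma IsNeighbour.apply_self {j : Fin d} {y y' : Lattice d} (h : IsNeighbour j y y') :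
    y' j = y j + 1 ∨ y' j = y j - 1 := by
  rcases h with rfl | rfl <;> simp

lemma IsNeighbour.apply_ne {j k : Fin d} {y y' : Lattice d} (h : IsNeighbour j y y') (hk : k ≠ j) :
    y' k = y k := by
  rcases h with rfl | rfl <;> simp [hk]

lemma IsNeighbour.abs_apply_sub_le {j : Fin d} {y y' : Lattice d} (h : IsNeighbour j y y')
    (k : Fin d) : |y' k - y k| ≤ 1 := by
  by_cases hk : k = j
  · subst hk
    rcases h.apply_self with h | h <;> simp [h]
  · simp [h.apply_ne hk]

lemma IsNeighbour.mem_innerBoundary {j : Fin d} {y y' : Lattice d} (h : IsNeighbour j y y')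
    {s : Finset (Lattice d)} (hy : y ∈ s) (hout : y' ∉ s) : y ∈ innerBoundary s := by
  rcases h with rfl | rfl
  · exact ⟨hy, j, Or.inl hout⟩
  · exact ⟨hy, j, Or.inr hout⟩

lemma IsNeighbour.exit_box {j : Fin d} {y y' a c : Lattice d} (h : IsNeighbour j y y')
    (hy : y ∈ Finset.Icc a c) (hy' : y' ∉ Finset.Icc a c) :
    (y j = c j ∧ y' j = c j + 1) ∨ (y j = a j ∧ y' j = a j - 1) := by
  rw [mem_box] at hy hy'
  have hyj := hy j
  by_contra hcon
  refine hy' fun k => ?_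
  by_cases hk : k = j
  · subst hk
    have := h.apply_self
    omega
  · rw [h.apply_ne hk]
    exact hy k

lemma natCast_le_norm_sub {L : ℕ} {u v : Lattice d} (j : Fin d) (h : (L : ℤ) ≤ |u j - v j|) :
    (L : ℝ) ≤ ‖u - v‖ := by
  refine le_trans ?_ (norm_le_pi_norm (u - v) j)
  rw [Pi.sub_apply, Int.norm_eq_abs]
  exact_mod_cast h

lemma dist_le_natCast_iff {n : ℕ} {x y : Lattice d} : dist x y ≤ n ↔ ∀ j, |x j - y j| ≤ n := by
  rw [dist_pi_le_iff n.cast_nonneg]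
  refine forall_congr' fun j => ?_
  rw [Int.dist_eq]
  exact_mod_cast Iff.rfl

lemma mem_centredBox {L : ℕ} {x : Lattice d} : x ∈ centredBox d L ↔ ∀ j, |x j| ≤ L := by
  simp only [centredBox, mem_box, abs_le]

lemma mem_centredBox_iff_norm_le {L : ℕ} {x : Lattice d} : x ∈ centredBox d L ↔ ‖x‖ ≤ L := by
  rw [mem_centredBox, ← dist_zero_right, dist_le_natCast_iff]
  simp only [Pi.zero_apply, sub_zero]

lemma exists_norm_eq (hd : 1 ≤ d) (y : Lattice d) :
    ∃ (i : Fin d) (r : ℕ), (∀ j, |y j| ≤ |y i|) ∧ |y i| = r ∧ ‖y‖ = r := by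
  have : Nonempty (Fin d) := ⟨⟨0, hd⟩⟩
  obtain ⟨i, hi⟩ := Finite.exists_max fun j => |y j|
  refine ⟨i, (y i).natAbs, hi, Int.abs_eq_natAbs _, le_antisymm ?_ ?_⟩
  · rw [← mem_centredBox_iff_norm_le, mem_centredBox]
    exact fun j => (hi j).trans_eq (Int.abs_eq_natAbs _)
  · simpa using natCast_le_norm_sub (L := (y i).natAbs) (u := y) (v := 0) i (by simp)

/-- The part of the box `[a, c]` with `i`-th coordinate at least `t`. -/
def slab (a c : Lattice d) (i : Fin d) (t : ℤ) : Finset (Lattice d) :=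
  Finset.Icc (Function.update a i t) c

section Slab

variable {a c : Lattice d} {i : Fin d} {t t' : ℤ}

lemma mem_slab (ht : a i ≤ t) {w : Lattice d} :
    w ∈ slab a c i t ↔ w ∈ Finset.Icc a c ∧ t ≤ w i := by
  simp only [slab, mem_box]
  refine ⟨fun h => ?_, fun ⟨hbox, hi⟩ j => ⟨?_, (hbox j).2⟩⟩
  · have hi : t ≤ w i := by simpa using (h i).1
    refine ⟨fun j => ⟨?_, (h j).2⟩, hi⟩
    by_cases hj : j = i
    · subst hj; omega
    · simpa [hj] using (h j).1
  · by_cases hj : j = i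
    · subst hj; simpa using hi
    · simpa [hj] using (hbox j).1

lemma slab_subset (ht : a i ≤ t) : slab a c i t ⊆ Finset.Icc a c :=
  fun _ hw => ((mem_slab ht).1 hw).1

lemma slab_subset_slab (ht : a i ≤ t) (htt' : t ≤ t') : slab a c i t' ⊆ slab a c i t := fun _ hw =>
  have hw' := (mem_slab (ht.trans htt')).1 hw
  (mem_slab ht).2 ⟨hw'.1, htt'.trans hw'.2⟩

lemma slab_self (a c : Lattice d) (i : Fin d) : slab a c i (a i) = Finset.Icc a c := by
  simp [slab]

lemma isBox_slab (a c : Lattice d) (i : Fin d) (t : ℤ) : IsBox (slab a c i t) := ⟨_, _, rfl⟩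

end Slab

/-- The lower corner of `flushRectangle`. -/
def flushCorner (a c u : Lattice d) (L : ℕ) (i : Fin d) : Lattice d :=
  Function.update (fun j => max (a j) (min (u j - L) (c j - 2 * L))) i (u i)

/-- The `L`-rectangle with thin side `[u i, u i + L]` whose other sides are centred at `u`, or
shifted just enough to stay in the box `[a, c]`. Inside the slab starting at `u`, it can only be
left at distance `L` from `u`. -/
def flushRectangle (a c u : Lattice d) (L : ℕ) (i : Fin d) : Finset (Lattice d) :=
  Finset.Icc (flushCorner a c u L i)
    fun j => flushCorner a c u L i j + if j = i then (L : ℤ) else 2 * (L : ℤ)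

section FlushRectangle

variable {a c u : Lattice d} {L : ℕ} {i : Fin d}

lemma isRectangle_flushRectangle : IsRectangle L (flushRectangle a c u L i) := ⟨_, i, rfl⟩

lemma mem_flushRectangle {w : Lattice d} :
    w ∈ flushRectangle a c u L i ↔ ∀ j, flushCorner a c u L i j ≤ w j ∧
      w j ≤ flushCorner a c u L i j + if j = i then (L : ℤ) else 2 * (L : ℤ) := mem_box

lemma flushCorner_self : flushCorner a c u L i i = u i := Function.update_self ..

lemma flushCorner_of_ne {j : Fin d} (hj : j ≠ i) :
    flushCorner a c u L i j = max (a j) (min (u j - L) (c j - 2 * L)) :=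
  Function.update_of_ne hj ..

lemma apply_mem_Icc_of_mem_flushRectangle {w : Lattice d} (hw : w ∈ flushRectangle a c u L i) :
    u i ≤ w i ∧ w i ≤ u i + L := by
  simpa [flushCorner_self] using mem_flushRectangle.1 hw i

lemma flushRectangle_subset_slab (hside : ∀ j, a j + 2 * L ≤ c j) (hu : u ∈ Finset.Icc a c)
    (hui : u i + L ≤ c i) : flushRectangle a c u L i ⊆ slab a c i (u i) := by
  intro w hw
  have hwi := apply_mem_Icc_of_mem_flushRectangle hw
  have hui' := (mem_box.1 hu i).1
  refine (mem_slab hui').2 ⟨mem_box.2 fun j => ?_, hwi.1⟩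
  have hwj := mem_flushRectangle.1 hw j
  have := hside j
  by_cases hj : j = i
  · subst hj; omega
  · rw [flushCorner_of_ne hj, if_neg hj] at hwj
    omega

lemma mem_innerBoundary_flushRectangle (hside : ∀ j, a j + 2 * L ≤ c j)
    (hu : u ∈ Finset.Icc a c) : u ∈ innerBoundary (flushRectangle a c u L i) := by
  refine ⟨mem_flushRectangle.2 fun j => ?_, i, Or.inr fun h => ?_⟩
  · have := hside j
    have := mem_box.1 hu j
    by_cases hj : j = i
    · subst hj
      simp [flushCorner_self]
    · rw [flushCorner_of_ne hj, if_neg hj]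
      omega
  · have hlow := (apply_mem_Icc_of_mem_flushRectangle h).1
    simp at hlow

lemma IsNeighbour.le_norm_sub_of_exit_flushRectangle {j : Fin d} {v v' : Lattice d}
    (hn : IsNeighbour j v v') (hv : v ∈ flushRectangle a c u L i)
    (hv' : v' ∉ flushRectangle a c u L i) (hui : a i ≤ u i) (hv's : v' ∈ slab a c i (u i)) :
    (L : ℝ) ≤ ‖u - v‖ := by
  have hexit := hn.exit_box hv hv'
  obtain ⟨hbox, hi⟩ := (mem_slab hui).1 hv's
  have hbox := mem_box.1 hbox j
  refine natCast_le_norm_sub j ?_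
  rw [le_abs]
  by_cases hj : j = i
  · subst hj
    rw [flushCorner_self, if_pos rfl] at hexit
    omega
  · rw [flushCorner_of_ne hj, if_neg hj] at hexit
    omega

end FlushRectangle

lemma IsRegular.norm_greenKernel_le {V : Lattice d → ℝ} {m b E : ℝ} {L : ℕ}
    {R s : Finset (Lattice d)} (hR : IsRegular V m b E L R) (hRs : R ⊆ s)
    (hs : HasResolvent V E s) {u z : Lattice d} (hu : u ∈ innerBoundary R) (hz : z ∈ s \ R)
    {C : ℝ} (hC0 : 0 ≤ C)
    (hexit : ∀ v ∈ R, ∀ j v', IsNeighbour j v v' → v' ∈ s \ R →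
      (L : ℝ) ≤ ‖u - v‖ ∧ ‖greenKernel V E s v' z‖ ≤ C) :
    ‖greenKernel V E s u z‖ ≤
      2 * d * R.card * (Real.exp (-m * ((L : ℝ) + (L : ℝ) ^ b)) * C) := by
  obtain ⟨hzs, hzR⟩ := Finset.mem_sdiff.1 hz
  refine norm_le_of_greenKernel_mul_le V (f := fun y => greenKernel V E s y z) hR.1 (fun y hy => ?_)
    hu.1 (by positivity) fun v hv j v' hn hv' => ?_
  · have hyz : y ≠ z := fun h => hzR (h ▸ hy)
    rw [formalSchrodinger_greenKernel V hs (hRs hy) hzs, if_neg hyz, add_zero]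
  · by_cases hv's : v' ∈ s
    · obtain ⟨hdist, hle⟩ := hexit v hv j v' hn (Finset.mem_sdiff.2 ⟨hv's, hv'⟩)
      have hdecay := hR.2 ⟨u, hu.1⟩ ⟨v, hv⟩ hu (hn.mem_innerBoundary hv hv') hdist
      rw [← greenKernel_coe] at hdecay
      exact mul_le_mul hdecay hle (norm_nonneg _) (Real.exp_pos _).le
    · rw [greenKernel_of_notMem_left V E z hv's, norm_zero, mul_zero]
      positivity

/-- The values `‖G_E[H_s](w, z)‖` of the resolvent kernel of the slab `s` starting at `t`, for
`w` in the face of `s` at height `t`. -/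
def faceNorms (V : Lattice d → ℝ) (E : ℝ) (a c : Lattice d) (i : Fin d) (z : Lattice d) (t : ℤ) :
    Set ℝ :=
  (fun w => ‖greenKernel V E (slab a c i t) w z‖) '' {w | w ∈ slab a c i t ∧ w i = t}

section SlabRecursion

variable {V : Lattice d → ℝ} {m b : ℝ} {J : ℕ} {E : ℝ} {L : ℕ} {a c : Lattice d} {P : ℝ}
  {i : Fin d} {z : Lattice d}

lemma two_mul_card_mul_le {s : Finset (Lattice d)} (hs : s ⊆ Finset.Icc a c)
    (hP : 2 * d * (Finset.Icc a c).card ≤ P) : 2 * d * (s.card : ℝ) ≤ P := by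
  refine le_trans ?_ hP
  gcongr

lemma norm_greenKernel_slab_le_of_mem_upperBounds (hd : 1 ≤ d)
    (hres : ¬ IsResonant V m b J E L (Finset.Icc a c)) (hP : 2 * d * (Finset.Icc a c).card ≤ P)
    {t t' : ℤ} (ht : a i ≤ t) (htt' : t < t') {v : Lattice d} (hv : v ∈ slab a c i t)
    (hvt : v i < t') (hz : z ∈ slab a c i t') {C : ℝ} (hC0 : 0 ≤ C)
    (hC : C ∈ upperBounds (faceNorms V E a c i z t')) :
    ‖greenKernel V E (slab a c i t) v z‖ ≤ resBound m b J L * P * C := by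
  have ht' : a i ≤ t' := ht.trans htt'.le
  have hη : 0 ≤ resBound m b J L := (Real.exp_pos _).le
  obtain ⟨hr, hη'⟩ := (isBox_slab a c i t).resolvent_of_not_isResonant hd hres (slab_subset ht)
  obtain ⟨hr', -⟩ := (isBox_slab a c i t').resolvent_of_not_isResonant hd hres (slab_subset ht')
  have hvt' : v ∉ slab a c i t' := fun h => by
    have := ((mem_slab ht').1 h).2
    omega
  refine (norm_greenKernel_le_of_ssubset V hr hr' (slab_subset_slab ht htt'.le)
    (Finset.mem_sdiff.2 ⟨hv, hvt'⟩) hz hη' hC0 fun y hy j y' hn hy' => ?_).trans ?_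
  · obtain ⟨hys, hys'⟩ := Finset.mem_sdiff.1 hy'
    have hyi := ((mem_slab ht').1 hy).2
    have hy'i : y' i < t' := by
      by_contra! h
      exact hys' ((mem_slab ht').2 ⟨slab_subset ht hys, h⟩)
    have hstep := abs_le.1 (hn.abs_apply_sub_le i)
    exact hC ⟨y, ⟨hy, by omega⟩, rfl⟩
  · calc 2 * d * ((slab a c i t').card : ℝ) * (C * resBound m b J L)
        ≤ P * (C * resBound m b J L) := by
          gcongr
          exact two_mul_card_mul_le (slab_subset ht') hP
      _ = resBound m b J L * P * C := by ring

lemma norm_greenKernel_slab_le_of_isRegular (hd : 1 ≤ d) (hside : ∀ j, a j + 2 * L ≤ c j)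
    (hres : ¬ IsResonant V m b J E L (Finset.Icc a c)) (hP : 2 * d * (Finset.Icc a c).card ≤ P)
    {u : Lattice d} (hu : u ∈ Finset.Icc a c) (hz : z ∈ Finset.Icc a c) (huz : u i + L + 2 ≤ z i)
    (hreg : IsRegular V m b E L (flushRectangle a c u L i)) {C : ℝ} (hC0 : 0 ≤ C)
    (hC : ∀ t', u i < t' → t' ≤ u i + L + 2 → C ∈ upperBounds (faceNorms V E a c i z t')) :
    ‖greenKernel V E (slab a c i (u i)) u z‖ ≤
      Real.exp (-m * ((L : ℝ) + (L : ℝ) ^ b)) * P * (resBound m b J L * P) * C := by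
  have hui : a i ≤ u i := (mem_box.1 hu i).1
  have hzc : z i ≤ c i := (mem_box.1 hz i).2
  have hP0 : 0 ≤ P := le_trans (by positivity) hP
  have hη : 0 ≤ resBound m b J L := (Real.exp_pos _).le
  have hR := flushRectangle_subset_slab (i := i) hside hu (by omega)
  obtain ⟨hr, -⟩ := (isBox_slab a c i (u i)).resolvent_of_not_isResonant hd hres (slab_subset hui)
  have hzR : z ∈ slab a c i (u i) \ flushRectangle a c u L i :=
    Finset.mem_sdiff.2 ⟨(mem_slab hui).2 ⟨hz, by omega⟩, fun h => by
      have := apply_mem_Icc_of_mem_flushRectangle h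
      omega⟩
  refine (hreg.norm_greenKernel_le hR hr (C := resBound m b J L * P * C)
    (mem_innerBoundary_flushRectangle hside hu) hzR (by positivity)
    fun v hv j v' hn hv' => ?_).trans ?_
  · obtain ⟨hv's, hv'R⟩ := Finset.mem_sdiff.1 hv'
    have hvi := apply_mem_Icc_of_mem_flushRectangle hv
    have hv'i := ((mem_slab hui).1 hv's).2
    have hstep := abs_le.1 (hn.abs_apply_sub_le i)
    exact ⟨hn.le_norm_sub_of_exit_flushRectangle hv hv'R hui hv's,
      norm_greenKernel_slab_le_of_mem_upperBounds hd hres hP hui (t' := v' i + 1) (by omega) hv's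
        (by omega) ((mem_slab (by omega)).2 ⟨hz, by omega⟩) hC0 (hC _ (by omega) (by omega))⟩
  · calc _ ≤ P * (Real.exp (-m * ((L : ℝ) + (L : ℝ) ^ b)) * (resBound m b J L * P * C)) := by
          gcongr
          exact two_mul_card_mul_le (hR.trans (slab_subset hui)) hP
      _ = _ := by ring

lemma IsRectangle.exists_apply_mem_Icc {R : Finset (Lattice d)} (hR : IsRectangle L R)
    (i : Fin d) : ∃ p : ℤ, ∀ w ∈ R, p ≤ w i ∧ w i ≤ p + 2 * L := by
  obtain ⟨a, k, rfl⟩ := hR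
  refine ⟨a i, fun w hw => ?_⟩
  have hwi := mem_box.1 hw i
  split_ifs at hwi <;> omega

lemma faceNorms_bound (hd : 1 ≤ d) (hm : 0 ≤ m) (hside : ∀ j, a j + 2 * L ≤ c j)
    (hres : ¬ IsResonant V m b J E L (Finset.Icc a c))
    (hsp : IsSparse J (singularRectangles V m b E L) (Finset.Icc a c)) {α : ℝ} (hP1 : 1 ≤ P)
    (hP : 2 * d * (Finset.Icc a c).card ≤ P) (hα : 0 ≤ α)
    (hαP : Real.exp (-m * ((L : ℝ) + (L : ℝ) ^ b)) * P * (resBound m b J L * P) ≤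
      Real.exp (-(α * (L + 2)))) (hz : z ∈ Finset.Icc a c) {t : ℤ} (ht : a i ≤ t) :
    ∃ n < J, resBound m b J L * (resBound m b J L * P) ^ n *
      Real.exp (-(α * ((z i : ℝ) - t - (L + 2) - n * (3 * L + 1)))) ∈
        upperBounds (faceNorms V E a c i z t) := by
  obtain ⟨n, hnJ, R, hR, hblock⟩ := hsp.exists_blocking_family
  choose p hp using fun j => (hR j).1.exists_apply_mem_Icc i
  have hη1 := one_le_resBound hm b J L
  have hjump : ∀ t t' C, 0 ≤ C → a i ≤ t → t < t' → t' ≤ z i →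
      C ∈ upperBounds (faceNorms V E a c i z t') →
        resBound m b J L * P * C ∈ upperBounds (faceNorms V E a c i z t) := by
    rintro t t' C hC0 ht htt' ht'z hC _ ⟨w, ⟨hw, rfl⟩, rfl⟩
    exact norm_greenKernel_slab_le_of_mem_upperBounds hd hres hP ht htt' hw htt'
      ((mem_slab (by omega)).2 ⟨hz, ht'z⟩) hC0 hC
  have hgood : ∀ t C, 0 ≤ C → a i ≤ t → t + (L + 2 : ℕ) ≤ z i →
      (∀ j, t ∉ Set.Icc (p j - L) (p j - L + (3 * L : ℕ))) →
      (∀ t', t < t' → t' ≤ t + (L + 2 : ℕ) → C ∈ upperBounds (faceNorms V E a c i z t')) →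
        Real.exp (-(α * (L + 2 : ℕ))) * C ∈ upperBounds (faceNorms V E a c i z t) := by
    rintro t C hC0 ht htz hfree hC _ ⟨u, ⟨hu, rfl⟩, rfl⟩
    push_cast at htz hC ⊢
    have hubox := slab_subset ht hu
    have hzc : z i ≤ c i := (mem_box.1 hz i).2
    have hreg : IsRegular V m b E L (flushRectangle a c u L i) := by
      by_contra hsing
      obtain ⟨j, hj⟩ := hblock _ ⟨isRectangle_flushRectangle, hsing⟩
        ((flushRectangle_subset_slab hside hubox (by omega)).trans (slab_subset ht))
      obtain ⟨w, hwu, hwR⟩ := Finset.not_disjoint_iff.1 hj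
      have hwi := apply_mem_Icc_of_mem_flushRectangle hwu
      have hwp := hp j w hwR
      exact hfree j ⟨by omega, by push_cast; omega⟩
    refine (norm_greenKernel_slab_le_of_isRegular hd hside hres hP hubox hz (by omega) hreg hC0
      fun t' ht' ht'L => hC t' ht' (by omega)).trans ?_
    gcongr
  have hbound := exp_bound_of_recursion (fun j => p j - L) (3 * L) (D := L + 2) (z := z i)
    (zero_le_one.trans hη1) (one_le_mul_of_one_le_of_one_le hη1 hP1) hα
    (fun t ht => by
      rintro _ ⟨w, -, rfl⟩
      exact ((isBox_slab a c i t).resolvent_of_not_isResonant hd hres (slab_subset ht)).2 w z)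
    hjump hgood ht
  refine ⟨n, hnJ, ?_⟩
  simpa using hbound

lemma norm_greenKernel_le_of_lt (hd : 1 ≤ d) (hm : 0 ≤ m) (hJL : J + 2 ≤ 2 * L)
    (hside : ∀ j, a j + 2 * L ≤ c j) (hres : ¬ IsResonant V m b J E L (Finset.Icc a c))
    (hsp : IsSparse J (singularRectangles V m b E L) (Finset.Icc a c)) {α : ℝ} (hP1 : 1 ≤ P)
    (hP : 2 * d * (Finset.Icc a c).card ≤ P) (hα : 0 ≤ α)
    (hαP : Real.exp (-m * ((L : ℝ) + (L : ℝ) ^ b)) * P * (resBound m b J L * P) ≤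
      Real.exp (-(α * (L + 2)))) {x : Lattice d} (hx : x ∈ Finset.Icc a c)
    (hz : z ∈ Finset.Icc a c) (hxz : x i < z i) :
    ‖greenKernel V E (Finset.Icc a c) x z‖ ≤
      resBound m b J L * (resBound m b J L * P) ^ J *
        Real.exp (-(α * ((z i : ℝ) - x i - 3 * J * L))) := by
  have hη1 := one_le_resBound hm b J L
  have hQ1 : 1 ≤ resBound m b J L * P := one_le_mul_of_one_le_of_one_le hη1 hP1
  have hax : a i ≤ x i := (mem_box.1 hx i).1
  obtain ⟨n, hnJ, hface⟩ := faceNorms_bound hd hm hside hres hsp hP1 hP hα hαP hz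
    (i := i) (t := x i + 1) (by omega)
  have hnJ' : (n : ℝ) + 1 ≤ J := by exact_mod_cast hnJ
  have hlength : (z i : ℝ) - x i - 3 * J * L ≤
      (z i : ℝ) - (x i + 1 : ℤ) - (L + 2) - n * (3 * L + 1) := by
    have hL : (J : ℝ) + 2 ≤ 2 * L := by exact_mod_cast hJL
    have hn : (n : ℝ) * (3 * L + 1) ≤ (J - 1) * (3 * L + 1) := by
      gcongr
      linarith
    push_cast
    linarith
  have hxa : x ∈ slab a c i (a i) := by rwa [slab_self]
  have hzx : z ∈ slab a c i (x i + 1) := (mem_slab (by omega)).2 ⟨hz, by omega⟩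
  have hle := norm_greenKernel_slab_le_of_mem_upperBounds hd hres hP le_rfl (by omega) hxa
    (by omega) hzx (by positivity) hface
  rw [slab_self] at hle
  calc ‖greenKernel V E (Finset.Icc a c) x z‖
      ≤ resBound m b J L * P * (resBound m b J L * (resBound m b J L * P) ^ n *
        Real.exp (-(α * ((z i : ℝ) - (x i + 1 : ℤ) - (L + 2) - n * (3 * L + 1))))) := hle
    _ = resBound m b J L * (resBound m b J L * P) ^ (n + 1) *
        Real.exp (-(α * ((z i : ℝ) - (x i + 1 : ℤ) - (L + 2) - n * (3 * L + 1)))) := by ring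
    _ ≤ resBound m b J L * (resBound m b J L * P) ^ J *
        Real.exp (-(α * ((z i : ℝ) - x i - 3 * J * L))) := by
      gcongr
      exact hnJ

lemma norm_greenKernel_le_exp (hd : 1 ≤ d) (hm : 0 ≤ m) (hJL : J + 2 ≤ 2 * L)
    (hside : ∀ j, a j + 2 * L ≤ c j) (hres : ¬ IsResonant V m b J E L (Finset.Icc a c))
    (hsp : IsSparse J (singularRectangles V m b E L) (Finset.Icc a c)) {α : ℝ} (hP1 : 1 ≤ P)
    (hP : 2 * d * (Finset.Icc a c).card ≤ P) (hα : 0 ≤ α)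
    (hαP : Real.exp (-m * ((L : ℝ) + (L : ℝ) ^ b)) * P * (resBound m b J L * P) ≤
      Real.exp (-(α * (L + 2)))) {x : Lattice d} (hx : x ∈ Finset.Icc a c)
    (hz : z ∈ Finset.Icc a c) (i : Fin d) :
    ‖greenKernel V E (Finset.Icc a c) x z‖ ≤
      resBound m b J L * (resBound m b J L * P) ^ J *
        Real.exp (-(α * (|(x i : ℝ) - z i| - 3 * J * L))) := by
  rcases lt_trichotomy (x i) (z i) with h | h | h
  · have h' : (x i : ℝ) < z i := by exact_mod_cast h
    rw [abs_of_neg (by linarith), neg_sub]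
    exact norm_greenKernel_le_of_lt hd hm hJL hside hres hsp hP1 hP hα hαP hx hz h
  · have hη1 := one_le_resBound hm b J L
    have hexp : 1 ≤ Real.exp (-(α * (|(x i : ℝ) - z i| - 3 * J * L))) := by
      rw [h, sub_self, abs_zero, zero_sub, mul_neg, neg_neg]
      exact Real.one_le_exp (by positivity)
    calc _ ≤ resBound m b J L :=
          (IsBox.resolvent_of_not_isResonant hd ⟨a, c, rfl⟩ hres subset_rfl).2 x z
      _ ≤ _ := by
        rw [mul_assoc]
        exact le_mul_of_one_le_right (zero_le_one.trans hη1) (one_le_mul_of_one_le_of_one_le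
          (one_le_pow₀ (one_le_mul_of_one_le_of_one_le hη1 hP1)) hexp)
  · have h' : (z i : ℝ) < x i := by exact_mod_cast h
    rw [abs_of_pos (by linarith), greenKernel_comm]
    exact norm_greenKernel_le_of_lt hd hm hJL hside hres hsp hP1 hP hα hαP hz hx h

end SlabRecursion

/-! ### Regularity at the next scale -/

/-- A bound for the number of nearest-neighbour bonds leaving a box, or any subset of one, whose
sides have at most `2 L + 1` points. -/
def bondBound (d L : ℕ) : ℝ := 2 * d * (2 * (L : ℝ) + 1) ^ d

lemma one_le_bondBound (hd : 1 ≤ d) (L : ℕ) : 1 ≤ bondBound d L := by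
  have hd' : (1 : ℝ) ≤ 2 * d := by
    have : (1 : ℝ) ≤ d := by exact_mod_cast hd
    linarith
  exact one_le_mul_of_one_le_of_one_le hd' (one_le_pow₀ (by simp))

lemma card_Icc_le {a c : Lattice d} {L : ℕ} (h : ∀ j, c j ≤ a j + 2 * L) :
    ((Finset.Icc a c).card : ℝ) ≤ (2 * (L : ℝ) + 1) ^ d := by
  have hcard : (Finset.Icc a c).card ≤ (2 * L + 1) ^ d := by
    rw [Pi.card_Icc]
    refine (Finset.prod_le_pow_card _ _ (2 * L + 1) fun j _ => ?_).trans (by simp)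
    rw [Int.card_Icc]
    have := h j
    omega
  exact_mod_cast hcard

lemma two_mul_card_Icc_le_bondBound {a c : Lattice d} {L : ℕ} (h : ∀ j, c j ≤ a j + 2 * L) :
    2 * d * ((Finset.Icc a c).card : ℝ) ≤ bondBound d L :=
  mul_le_mul_of_nonneg_left (card_Icc_le h) (by positivity)

/-- The numerical requirements on two consecutive scales `L` and `L'` that make one step of the
multi-scale analysis work. -/
structure GoodScales (d : ℕ) (m b : ℝ) (J L L' : ℕ) : Prop where
  le_two_mul : J + 2 ≤ 2 * L
  mul_le : 1000 * (J + 1) * L ≤ L'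
  le_rpow : 16 ≤ (L : ℝ) ^ b
  rpow_le : (L : ℝ) ^ b ≤ L
  bondBound_pow_le : bondBound d L' ^ (J + 2) ≤ Real.exp (m / 16 * (L : ℝ) ^ b)
  rpow_le_mul : 16 * (L' : ℝ) ^ b ≤ (L : ℝ) ^ (b - 1) * L'
  mul_le_mul : 16 * ((3 * J + 1) * (L : ℝ)) ≤ (L : ℝ) ^ (b - 1) * L'

section Eventually

lemma eventually_mul_rpow_le (C : ℝ) {s r : ℝ} (h : s < r) :
    ∀ᶠ x : ℝ in atTop, C * x ^ s ≤ x ^ r := by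
  filter_upwards [(tendsto_rpow_atTop (sub_pos.2 h)).eventually_ge_atTop C,
    eventually_gt_atTop 0] with x hx hx0
  calc C * x ^ s ≤ x ^ (r - s) * x ^ s := by gcongr
    _ = x ^ r := by rw [← Real.rpow_add hx0, sub_add_cancel]

lemma eventually_mul_rpow_le_exp (C s : ℝ) {a r : ℝ} (ha : 0 < a) (hr : 0 < r) :
    ∀ᶠ x : ℝ in atTop, C * x ^ s ≤ Real.exp (a * x ^ r) := by
  have hexp := ((isLittleO_rpow_exp_pos_mul_atTop (s / r) ha).const_mul_left C).bound one_pos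
  filter_upwards [(tendsto_rpow_atTop hr).eventually hexp, eventually_gt_atTop 0] with x hx hx0
  rw [← Real.rpow_mul hx0.le, mul_div_cancel₀ _ hr.ne', one_mul, Real.norm_eq_abs,
    Real.norm_eq_abs, Real.abs_exp] at hx
  exact (le_abs_self _).trans hx

variable {γ : ℝ} {L : ℕ}

lemma half_rpow_le_floor (hL : 2 ≤ (L : ℝ) ^ γ) : (L : ℝ) ^ γ / 2 ≤ ⌊(L : ℝ) ^ γ⌋₊ := by
  have := Nat.lt_floor_add_one ((L : ℝ) ^ γ)
  linarith

lemma bondBound_floor_rpow_pow_le (d n : ℕ) (hL : 1 ≤ (L : ℝ) ^ γ) :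
    bondBound d ⌊(L : ℝ) ^ γ⌋₊ ^ n ≤ (2 * d * 3 ^ d) ^ n * (L : ℝ) ^ (γ * (d * n : ℕ)) := by
  have hfloor : (⌊(L : ℝ) ^ γ⌋₊ : ℝ) ≤ (L : ℝ) ^ γ := Nat.floor_le (by positivity)
  have hside : 2 * (⌊(L : ℝ) ^ γ⌋₊ : ℝ) + 1 ≤ 3 * (L : ℝ) ^ γ := by linarith
  calc bondBound d ⌊(L : ℝ) ^ γ⌋₊ ^ n
      ≤ (2 * d * (3 * (L : ℝ) ^ γ) ^ d) ^ n := by unfold bondBound; gcongr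
    _ = (2 * d * 3 ^ d) ^ n * (L : ℝ) ^ (γ * (d * n : ℕ)) := by
      rw [Real.rpow_mul_natCast (Nat.cast_nonneg L)]
      ring

lemma eventually_goodScales {m b : ℝ} (d J : ℕ) (hm : 0 < m) (hb0 : 0 < b) (hb1 : b < 1)
    (hγ : 2 - b < γ) : ∀ᶠ L : ℕ in atTop, GoodScales d m b J L ⌊(L : ℝ) ^ γ⌋₊ := by
  have hγb : γ * b < b - 1 + γ := by nlinarith
  filter_upwards [eventually_ge_atTop (J + 2), tendsto_natCast_atTop_atTop.eventually
      (eventually_mul_rpow_le (2000 * (J + 1)) (show 1 < γ by linarith)),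
    tendsto_natCast_atTop_atTop.eventually (eventually_mul_rpow_le 16 hb0),
    tendsto_natCast_atTop_atTop.eventually (eventually_mul_rpow_le_exp
      ((2 * d * 3 ^ d) ^ (J + 2)) (γ * (d * (J + 2) : ℕ)) (show 0 < m / 16 by linarith) hb0),
    tendsto_natCast_atTop_atTop.eventually (eventually_mul_rpow_le 32 hγb),
    tendsto_natCast_atTop_atTop.eventually (eventually_mul_rpow_le (32 * (3 * J + 1))
      (show 1 < b - 1 + γ by linarith))]
    with L hJL hmul hb hbond hpow hlin
  rw [Real.rpow_one] at hmul hlin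
  rw [Real.rpow_zero, mul_one] at hb
  have hL : (1 : ℝ) ≤ L := by exact_mod_cast (by omega : 1 ≤ L)
  have hL0 : (0 : ℝ) < L := by linarith
  have hLγ : 2 ≤ (L : ℝ) ^ γ := by nlinarith
  have hfloor := half_rpow_le_floor hLγ
  have hhalf : (L : ℝ) ^ (b - 1 + γ) / 2 ≤ (L : ℝ) ^ (b - 1) * ⌊(L : ℝ) ^ γ⌋₊ := by
    rw [Real.rpow_add hL0, mul_div_assoc]
    gcongr
  have hfloor_rpow : (⌊(L : ℝ) ^ γ⌋₊ : ℝ) ^ b ≤ (L : ℝ) ^ (γ * b) := by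
    rw [Real.rpow_mul hL0.le]
    gcongr
    exact Nat.floor_le (by positivity)
  refine ⟨by omega, ?_, hb, ?_, (bondBound_floor_rpow_pow_le d (J + 2) (by linarith)).trans hbond,
    by linarith, by linarith⟩
  · have : 1000 * ((J : ℝ) + 1) * L ≤ ⌊(L : ℝ) ^ γ⌋₊ := by linarith
    exact_mod_cast this
  · simpa using Real.rpow_le_rpow_of_exponent_le hL hb1.le

end Eventually

lemma resBound_pow_le {m : ℝ} (hm : 0 ≤ m) (b : ℝ) (J L : ℕ) :
    resBound m b J L ^ (J + 1) ≤ Real.exp (m / 8 * (L : ℝ) ^ b) := by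
  rw [resBound, ← Real.exp_nat_mul, Real.exp_le_exp]
  have hJ : ((J : ℝ) + 1) / (16 * J) ≤ 1 / 8 := by
    rcases J.eq_zero_or_pos with rfl | hJ
    · simp
    · have hJ1 : (1 : ℝ) ≤ J := by exact_mod_cast hJ
      rw [div_le_div_iff₀ (by positivity) (by norm_num)]
      linarith
  calc ((J + 1 : ℕ) : ℝ) * (m * (L : ℝ) ^ b / (16 * J))
      = m * (L : ℝ) ^ b * (((J : ℝ) + 1) / (16 * J)) := by push_cast; ring
    _ ≤ m * (L : ℝ) ^ b * (1 / 8) := by gcongr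
    _ = m / 8 * (L : ℝ) ^ b := by ring

/-- The decay rate of resolvent kernels at the next scale. Its excess over `m` pays for the factor
`exp (-m L' ^ b)` demanded by regularity at that scale. -/
def decayRate (m b : ℝ) (L : ℕ) : ℝ := m + m / 4 * (L : ℝ) ^ (b - 1)

lemma le_decayRate {m : ℝ} (hm : 0 ≤ m) (b : ℝ) (L : ℕ) : m ≤ decayRate m b L :=
  le_add_of_nonneg_right (by positivity)

namespace GoodScales

variable {m b : ℝ} {J L L' : ℕ}

lemma le (h : GoodScales d m b J L L') : L ≤ L' := by
  have := h.mul_le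
  nlinarith

lemma two_le (h : GoodScales d m b J L L') : (2 : ℝ) ≤ L := by
  linarith [h.le_rpow, h.rpow_le]

lemma rpow_sub_one_mul (h : GoodScales d m b J L L') : (L : ℝ) ^ (b - 1) * L = (L : ℝ) ^ b := by
  have hL := h.two_le
  rw [Real.rpow_sub_one (by linarith), div_mul_cancel₀ _ (by linarith)]

lemma step_le (h : GoodScales d m b J L L') (hd : 1 ≤ d) (hm : 0 ≤ m) :
    Real.exp (-m * ((L : ℝ) + (L : ℝ) ^ b)) * bondBound d L' *
      (resBound m b J L * bondBound d L') ≤ Real.exp (-(decayRate m b L * (L + 2))) := by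
  have hη := (le_self_pow₀ (one_le_resBound hm b J L) J.succ_ne_zero).trans
    (resBound_pow_le hm b J L)
  have hP : bondBound d L' ^ 2 ≤ Real.exp (m / 16 * (L : ℝ) ^ b) :=
    (pow_le_pow_right₀ (one_le_bondBound hd L') (by omega)).trans h.bondBound_pow_le
  have hrate : decayRate m b L * (L + 2) ≤ m * L + 5 / 8 * (m * (L : ℝ) ^ b) := by
    have hle_rpow := mul_le_mul_of_nonneg_left h.le_rpow hm
    have htwo : (L : ℝ) ^ (b - 1) * 2 ≤ (L : ℝ) ^ b := by
      rw [← h.rpow_sub_one_mul]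
      gcongr
      exact h.two_le
    calc decayRate m b L * (L + 2)
        = m * L + 2 * m + m / 4 * ((L : ℝ) ^ (b - 1) * L) + m / 4 * ((L : ℝ) ^ (b - 1) * 2) := by
          unfold decayRate
          ring
      _ ≤ m * L + 2 * m + m / 4 * (L : ℝ) ^ b + m / 4 * (L : ℝ) ^ b := by
          rw [h.rpow_sub_one_mul]
          gcongr
      _ ≤ _ := by linarith
  calc _ = Real.exp (-m * ((L : ℝ) + (L : ℝ) ^ b)) * resBound m b J L * bondBound d L' ^ 2 := by
        ring
    _ ≤ Real.exp (-m * ((L : ℝ) + (L : ℝ) ^ b)) * Real.exp (m / 8 * (L : ℝ) ^ b) *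
        Real.exp (m / 16 * (L : ℝ) ^ b) := by gcongr
    _ = Real.exp (-(m * L + 13 / 16 * (m * (L : ℝ) ^ b))) := by
        rw [← Real.exp_add, ← Real.exp_add]
        congr 1
        ring
    _ ≤ _ := by
        have : 0 ≤ m * (L : ℝ) ^ b := by positivity
        gcongr
        linarith

lemma prefactor_le (h : GoodScales d m b J L L') (hd : 1 ≤ d) (hm : 0 ≤ m) :
    resBound m b J L * (resBound m b J L * bondBound d L') ^ J * bondBound d L' ≤
      Real.exp (m / 4 * (L : ℝ) ^ b) := by
  have hP : bondBound d L' ^ (J + 1) ≤ Real.exp (m / 16 * (L : ℝ) ^ b) :=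
    (pow_le_pow_right₀ (one_le_bondBound hd L') (by omega)).trans h.bondBound_pow_le
  calc _ = resBound m b J L ^ (J + 1) * bondBound d L' ^ (J + 1) := by ring
    _ ≤ Real.exp (m / 8 * (L : ℝ) ^ b) * Real.exp (m / 16 * (L : ℝ) ^ b) := by
        gcongr
        · exact pow_nonneg (zero_le_one.trans (one_le_bondBound hd L')) _
        · exact resBound_pow_le hm b J L
    _ ≤ _ := by
        rw [← Real.exp_add, Real.exp_le_exp]
        have : 0 ≤ m * (L : ℝ) ^ b := by positivity
        linarith

lemma bondBound_le_exp (h : GoodScales d m b J L L') (hd : 1 ≤ d) (hm : 0 ≤ m) :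
    bondBound d L' ≤ Real.exp (m * L) := by
  have hexp := (le_self_pow₀ (one_le_bondBound hd L') (Nat.succ_ne_zero _)).trans
    h.bondBound_pow_le
  refine hexp.trans (Real.exp_le_exp.2 ?_)
  have := mul_le_mul_of_nonneg_left h.rpow_le hm
  have : 0 ≤ m * L := by positivity
  linarith

lemma mul_add_rpow_le (h : GoodScales d m b J L L') (hm : 0 ≤ m) :
    m * ((L' : ℝ) + (L' : ℝ) ^ b) + m / 4 * (L : ℝ) ^ b ≤
      decayRate m b L * (L' - 3 * J * L) := by
  have hL' : 1000 * ((J : ℝ) + 1) * L ≤ L' := by exact_mod_cast h.mul_le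
  have hhalf : (L' : ℝ) / 2 ≤ L' - 3 * J * L := by
    have : (0 : ℝ) ≤ J * L := by positivity
    nlinarith
  calc m * ((L' : ℝ) + (L' : ℝ) ^ b) + m / 4 * (L : ℝ) ^ b
      ≤ m * (L' + (L : ℝ) ^ (b - 1) * L' / 16) + m / 4 * L := by
        gcongr
        · linarith [h.rpow_le_mul]
        · exact h.rpow_le
    _ ≤ m * (L' - 3 * J * L) + m / 4 * (L : ℝ) ^ (b - 1) * (L' / 2) := by
        have := mul_le_mul_of_nonneg_left h.mul_le_mul hm
        have : 0 ≤ m * L := by positivity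
        linarith
    _ ≤ m * (L' - 3 * J * L) + m / 4 * (L : ℝ) ^ (b - 1) * (L' - 3 * J * L) := by gcongr
    _ = decayRate m b L * (L' - 3 * J * L) := by
        unfold decayRate
        ring

variable {V : Lattice d → ℝ} {E : ℝ}

lemma norm_greenKernel_mul_bondBound_le (hg : GoodScales d m b J L L') (hd : 1 ≤ d) (hm : 0 ≤ m)
    {α : ℝ} (hα0 : 0 ≤ α) (hα : α ≤ decayRate m b L) {a c : Lattice d}
    (hside : ∀ j, a j + 2 * L ≤ c j) (hside' : ∀ j, c j ≤ a j + 2 * L')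
    (hres : ¬ IsResonant V m b J E L (Finset.Icc a c))
    (hsp : IsSparse J (singularRectangles V m b E L) (Finset.Icc a c)) {x z : Lattice d}
    (hx : x ∈ Finset.Icc a c) (hz : z ∈ Finset.Icc a c) (i : Fin d) :
    ‖greenKernel V E (Finset.Icc a c) x z‖ * bondBound d L' ≤
      Real.exp (m / 4 * (L : ℝ) ^ b) * Real.exp (-(α * (|(x i : ℝ) - z i| - 3 * J * L))) := by
  have hP1 := one_le_bondBound hd L'
  have hstep : Real.exp (-m * ((L : ℝ) + (L : ℝ) ^ b)) * bondBound d L' *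
      (resBound m b J L * bondBound d L') ≤ Real.exp (-(α * (L + 2))) :=
    (hg.step_le hd hm).trans (by gcongr)
  have hG := norm_greenKernel_le_exp hd hm hg.le_two_mul hside hres hsp hP1
    (two_mul_card_Icc_le_bondBound hside') hα0 hstep hx hz i
  calc _ ≤ resBound m b J L * (resBound m b J L * bondBound d L') ^ J *
          Real.exp (-(α * (|(x i : ℝ) - z i| - 3 * J * L))) * bondBound d L' := by gcongr
    _ = resBound m b J L * (resBound m b J L * bondBound d L') ^ J * bondBound d L' *
          Real.exp (-(α * (|(x i : ℝ) - z i| - 3 * J * L))) := by ring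
    _ ≤ _ := by
        gcongr
        exact hg.prefactor_le hd hm

lemma norm_greenKernel_mul_bondBound_le_exp (hg : GoodScales d m b J L L') (hd : 1 ≤ d)
    (hm : 0 ≤ m) {a c : Lattice d} (hside : ∀ j, a j + 2 * L ≤ c j)
    (hside' : ∀ j, c j ≤ a j + 2 * L') (hres : ¬ IsResonant V m b J E L (Finset.Icc a c))
    (hsp : IsSparse J (singularRectangles V m b E L) (Finset.Icc a c)) {x z : Lattice d}
    (hx : x ∈ Finset.Icc a c) (hz : z ∈ Finset.Icc a c) (i : Fin d) :
    ‖greenKernel V E (Finset.Icc a c) x z‖ * bondBound d L' ≤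
      Real.exp (-(m * (|(x i : ℝ) - z i| - (3 * J + 1) * L))) := by
  refine (hg.norm_greenKernel_mul_bondBound_le hd hm hm (le_decayRate hm b L) hside hside' hres hsp
    hx hz i).trans ?_
  rw [← Real.exp_add, Real.exp_le_exp]
  have := mul_le_mul_of_nonneg_left hg.rpow_le hm
  have : 0 ≤ m * L := by positivity
  linarith

lemma isRegular (hg : GoodScales d m b J L L') (hd : 1 ≤ d) (hm : 0 ≤ m)
    {R : Finset (Lattice d)} (hR : IsRectangle L' R) (hres : ¬ IsResonant V m b J E L R)
    (hsp : IsSparse J (singularRectangles V m b E L) R) : IsRegular V m b E L' R := by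
  obtain ⟨a, _, rfl⟩ := hR
  refine ⟨(IsBox.resolvent_of_not_isResonant hd ⟨_, _, rfl⟩ hres subset_rfl).1,
    fun x z _ _ hxz => ?_⟩
  obtain ⟨i, r, -, hir, hr⟩ := exists_norm_eq hd ((x : Lattice d) - z)
  have hi : (L' : ℝ) ≤ |((x : Lattice d) i : ℝ) - (z : Lattice d) i| := by
    rw [hr] at hxz
    exact hxz.trans_eq (by exact_mod_cast hir.symm)
  have hmul := hg.mul_le
  have hJL : 0 ≤ J * L := Nat.zero_le _
  have hα0 : 0 ≤ decayRate m b L := hm.trans (le_decayRate hm b L)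
  rw [← greenKernel_coe]
  calc _ ≤ ‖greenKernel V E _ x z‖ * bondBound d L' :=
        le_mul_of_one_le_right (norm_nonneg _) (one_le_bondBound hd L')
    _ ≤ Real.exp (m / 4 * (L : ℝ) ^ b) *
        Real.exp (-(decayRate m b L * (|((x : Lattice d) i : ℝ) - (z : Lattice d) i| -
          3 * J * L))) := by
        refine hg.norm_greenKernel_mul_bondBound_le hd hm hα0 le_rfl (fun j => ?_) (fun j => ?_)
          hres hsp x.2 z.2 i
        · split_ifs <;> linarith
        · split_ifs <;> omega
    _ ≤ Real.exp (m / 4 * (L : ℝ) ^ b) *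
        Real.exp (-(decayRate m b L * (L' - 3 * J * L))) := by gcongr
    _ ≤ _ := by
        rw [← Real.exp_add, Real.exp_le_exp]
        linarith [hg.mul_add_rpow_le hm]

lemma one_le (hg : GoodScales d m b J L L') : 1 ≤ L := by
  have := hg.le_two_mul
  omega

lemma thousand_mul_le (hg : GoodScales d m b J L L') : 1000 * L ≤ L' := by
  have hJL : 0 ≤ J * L := Nat.zero_le _
  linarith [hg.mul_le]

lemma mul_add_one_le (hg : GoodScales d m b J L L') : 250 * ((3 * J + 1) * L + 1) ≤ L' := by
  linarith [hg.mul_le, hg.one_le]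

lemma mul_le_half_sub (hg : GoodScales d m b J L L') :
    3 / 8 * (L' : ℝ) ≤ ((L' / 2 : ℕ) : ℝ) - (3 * J + 1) * L := by
  have hloss : (250 * ((3 * J + 1) * L + 1) : ℝ) ≤ L' := by exact_mod_cast hg.mul_add_one_le
  have hhalf : (L' : ℝ) ≤ 2 * (L' / 2 : ℕ) + 1 := by
    exact_mod_cast (by omega : L' ≤ 2 * (L' / 2) + 1)
  have hL : (0 : ℝ) ≤ (3 * J + 1) * L := by positivity
  linarith

lemma norm_apply_le (hg : GoodScales d m b J L L') (hd : 1 ≤ d) (hm : 0 ≤ m)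
    {a c : Lattice d} (hside : ∀ j, a j + 2 * L ≤ c j)
    (hside' : ∀ j, c j ≤ a j + 2 * L') (hres : ¬ IsResonant V m b J E L (Finset.Icc a c))
    (hsp : IsSparse J (singularRectangles V m b E L) (Finset.Icc a c)) {f : Lattice d → ℂ}
    (hf : ∀ y ∈ Finset.Icc a c, formalSchrodinger V f y = E * f y) {x : Lattice d} {δ : ℕ}
    (hx : ∀ j, a j + δ ≤ x j ∧ x j + δ ≤ c j) {M : ℝ} (hM0 : 0 ≤ M)
    (hM : ∀ y, (∀ j, a j - 1 ≤ y j ∧ y j ≤ c j + 1) → ‖f y‖ ≤ M) :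
    ‖f x‖ ≤ Real.exp (-(m * (δ - (3 * J + 1) * L))) * M := by
  have hxB : x ∈ Finset.Icc a c := mem_box.2 fun j => by have := hx j; omega
  have hbond : 0 < bondBound d L' := one_pos.trans_le (one_le_bondBound hd L')
  set q := Real.exp (-(m * (δ - (3 * J + 1) * L)))
  have hexit (y : Lattice d) (hy : y ∈ Finset.Icc a c) (j : Fin d) (y' : Lattice d)
      (hn : IsNeighbour j y y') (hy' : y' ∉ Finset.Icc a c) :
      ‖greenKernel V E (Finset.Icc a c) x y‖ * ‖f y'‖ ≤ q / bondBound d L' * M := by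
    have hδ : (δ : ℤ) ≤ |x j - y j| := by
      have := hx j
      have := hn.exit_box hy hy'
      rw [le_abs]
      omega
    have hδ : (δ : ℝ) ≤ |(x j : ℝ) - y j| := by exact_mod_cast hδ
    have hgreen : ‖greenKernel V E (Finset.Icc a c) x y‖ ≤ q / bondBound d L' := by
      rw [le_div_iff₀ hbond]
      refine
        (hg.norm_greenKernel_mul_bondBound_le_exp hd hm hside hside' hres hsp hxB hy j).trans ?_
      exact Real.exp_le_exp.2 (by gcongr)
    refine mul_le_mul_of_nonneg hgreen (hM y' fun k => ?_) (norm_nonneg _) hM0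
    have := mem_box.1 hy k
    have := abs_le.1 (hn.abs_apply_sub_le k)
    omega
  calc ‖f x‖ ≤ 2 * d * ((Finset.Icc a c).card : ℝ) * (q / bondBound d L' * M) :=
        norm_le_of_greenKernel_mul_le V
          (IsBox.resolvent_of_not_isResonant hd ⟨a, c, rfl⟩ hres subset_rfl).1 hf hxB
          (by positivity) hexit
    _ ≤ bondBound d L' * (q / bondBound d L' * M) := by
        gcongr
        exact two_mul_card_Icc_le_bondBound hside'
    _ = q * M := by field_simp

end GoodScales

lemma le_pow_mul_of_forall_dist_le {X : Type*} [PseudoMetricSpace X] {f : X → ℝ} {q M D : ℝ}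
    (hq : 0 ≤ q) (hM : 0 ≤ M) (hD : 0 ≤ D) (n : ℕ) {y : X}
    (hstep : ∀ x, dist x y ≤ n * D → ∀ M', 0 ≤ M' → (∀ z, dist z x ≤ D → f z ≤ M') → f x ≤ q * M')
    (hf : ∀ x, dist x y ≤ n * D → f x ≤ M) : f y ≤ q ^ n * M := by
  induction n generalizing y with
  | zero => simpa using hf y (by simp)
  | succ n ih =>
    have hball {x z : X} (hx : dist x y ≤ D) (hz : dist z x ≤ n * D) :
        dist z y ≤ (n + 1 : ℕ) * D := by
      push_cast
      linarith [dist_triangle z x y]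
    rw [pow_succ', mul_assoc]
    refine hstep y (by rw [dist_self]; positivity) _ (by positivity) fun x hx => ?_
    exact ih (fun z hz => hstep z (hball hx hz)) fun z hz => hf z (hball hx hz)

lemma IsSparse.notMem_of_disjoint {S : Set (Finset (Lattice d))} {B R R' : Finset (Lattice d)}
    (h : IsSparse 2 S B) (hR : R ∈ S) (hRB : R ⊆ B) (hR'B : R' ⊆ B) (hdisj : Disjoint R R') :
    R' ∉ S := fun hR' => by
  refine h ⟨![R, R'], Fin.forall_fin_two.2 ⟨⟨hR, hRB⟩, hR', hR'B⟩, fun i j hij => ?_⟩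
  fin_cases i <;> fin_cases j
  exacts [absurd rfl hij, hdisj, hdisj.symm, absurd rfl hij]

/-- The `L`-rectangle centred at `w` in all directions but the `i`-th, in which it is
`[t, t + L]`. -/
def rectangle (w : Lattice d) (i : Fin d) (t : ℤ) (L : ℕ) : Finset (Lattice d) :=
  Finset.Icc (fun j => if j = i then t else w j - L) (fun j => if j = i then t + L else w j + L)

section Rectangle

variable {w u : Lattice d} {i : Fin d} {t : ℤ} {L : ℕ}

lemma isRectangle_rectangle : IsRectangle L (rectangle w i t L) := by
  refine ⟨fun j => if j = i then t else w j - L, i, ?_⟩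
  rw [rectangle]
  congr 1
  funext j
  beta_reduce
  split_ifs <;> ring

lemma mem_rectangle :
    u ∈ rectangle w i t L ↔
      (t ≤ u i ∧ u i ≤ t + L) ∧ ∀ j ≠ i, w j - L ≤ u j ∧ u j ≤ w j + L := by
  rw [rectangle, mem_box]
  refine ⟨fun h => ⟨by simpa using h i, fun j hj => by simpa [hj] using h j⟩, fun h j => ?_⟩
  by_cases hj : j = i
  · subst hj
    simpa using h.1
  · simpa [hj] using h.2 j hj

lemma abs_sub_le_of_mem_rectangle (ht : t ≤ w i) (ht' : w i ≤ t + L) (hu : u ∈ rectangle w i t L)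
    (j : Fin d) : |u j - w j| ≤ L := by
  obtain ⟨hi, hne⟩ := mem_rectangle.1 hu
  rw [abs_le]
  by_cases hj : j = i
  · subst hj
    omega
  · have := hne j hj
    omega

lemma rectangle_subset_centredBox {N : ℕ} (ht : t ≤ w i) (ht' : w i ≤ t + L)
    (hw : ∀ j, |w j| + L ≤ N) : rectangle w i t L ⊆ centredBox d N := fun u hu =>
  mem_centredBox.2 fun j => by
    have := abs_sub_le_of_mem_rectangle ht ht' hu j
    have := abs_sub_abs_le_abs_sub (u j) (w j)
    have := hw j
    omega

lemma centredBox_subset_rectangle {q : ℕ} (hqL : q ≤ L) (ht : t ≤ -q) (ht' : q ≤ t + L) :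
    centredBox d q ⊆ rectangle 0 i t L := fun u hu => by
  have hu (j : Fin d) := abs_le.1 (mem_centredBox.1 hu j)
  refine mem_rectangle.2 ⟨by have := hu i; omega, fun j _ => ?_⟩
  have := hu j
  rw [Pi.zero_apply]
  omega

lemma disjoint_rectangle {t' : ℤ} (h : t + L < t' ∨ t' + L < t) :
    Disjoint (rectangle w i t L) (rectangle u i t' L) :=
  Finset.disjoint_left.2 fun v hv hv' => by
    have := (mem_rectangle.1 hv).1
    have := (mem_rectangle.1 hv').1
    omega

end Rectangle

lemma exists_disjoint_intervals {s : ℤ} {q δ L : ℕ} (hq : 2 * q ≤ L) (hδ : 2 * δ ≤ L)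
    (hs : q + 1 + δ ≤ |s|) :
    ∃ t₀ t : ℤ, (t₀ ≤ -q ∧ q ≤ t₀ + L) ∧ (t + δ ≤ s ∧ s + δ ≤ t + L) ∧
      (t₀ + L < t ∨ t + L < t₀) := by
  rcases abs_cases s with ⟨hsign, -⟩ | ⟨hsign, -⟩
  · exact ⟨q - L, s - δ, by omega⟩
  · exact ⟨-q, s + δ - L, by omega⟩

/-- The hypotheses of the multi-scale analysis at the energy `E`, for the sequence of scales `ℓ`,
with sparsity of the singular rectangles at every scale. -/
structure SparseAtAllScales (V : Lattice d → ℝ) (m b : ℝ) (J : ℕ) (E : ℝ) (ℓ : ℕ → ℕ) : Prop where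
  scales : ∀ k, GoodScales d m b J (ℓ k) (ℓ (k + 1))
  singular : ∀ k R, IsRectangle (ℓ (k + 1)) R →
    IsSparse J (singularRectangles V m b E (ℓ k)) R
  resonant : ∀ k, IsSparse 2 (resonantRectangles V m b J E (ℓ k) (ℓ (k + 1)))
    (centredBox d (ℓ (k + 2)))

/-- The central box of the `k`-th scale is resonant. Its radius `ℓ (k + 1) / 8` leaves room for an
`ℓ (k + 1)`-rectangle disjoint from one that contains it. -/
def IsCentrallyResonant (V : Lattice d → ℝ) (m b : ℝ) (J : ℕ) (E : ℝ) (ℓ : ℕ → ℕ) (k : ℕ) : Prop :=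
  IsResonant V m b J E (ℓ k) (centredBox d (ℓ (k + 1) / 8))

section Scales

variable {V : Lattice d → ℝ} {m b : ℝ} {J : ℕ} {E : ℝ} {ℓ : ℕ → ℕ}

lemma sparseAtAllScales (hd : 1 ≤ d) (hm : 0 ≤ m)
    (hscales : ∀ k, GoodScales d m b J (ℓ k) (ℓ (k + 1)))
    (hres : ∀ k R, IsRectangle (ℓ (k + 2)) R →
      IsSparse J (resonantRectangles V m b J E (ℓ k) (ℓ (k + 1))) R)
    (hres2 : ∀ k, IsSparse 2 (resonantRectangles V m b J E (ℓ k) (ℓ (k + 1)))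
      (centredBox d (ℓ (k + 2))))
    (hsing : ∀ R, IsRectangle (ℓ 1) R → IsSparse J (singularRectangles V m b E (ℓ 0)) R) :
    SparseAtAllScales V m b J E ℓ := by
  refine ⟨hscales, fun k => ?_, hres2⟩
  induction k with
  | zero => exact hsing
  | succ k ih =>
    intro R hR
    refine (hres k R hR).mono (fun R' hR' => ⟨hR'.1, ?_⟩) subset_rfl
    by_contra hnres
    exact hR'.2 ((hscales k).isRegular hd hm hR'.1 hnres (ih R' hR'.1))

namespace SparseAtAllScales

variable (h : SparseAtAllScales V m b J E ℓ) {k : ℕ} {f : Lattice d → ℂ}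

include h

lemma isSparse_centredBox (hd : 1 ≤ d) (k : ℕ) :
    IsSparse J (singularRectangles V m b E (ℓ k)) (centredBox d (ℓ (k + 1) / 8)) :=
  (h.singular k (rectangle 0 ⟨0, hd⟩ (-(ℓ (k + 1) / 8 : ℕ)) (ℓ (k + 1)))
    isRectangle_rectangle).mono subset_rfl
    (centredBox_subset_rectangle (by omega) le_rfl (by omega))

lemma norm_apply_le_of_not_isCentrallyResonant (hd : 1 ≤ d) (hm : 0 ≤ m)
    (hres : ¬ IsCentrallyResonant V m b J E ℓ k)
    (hf : ∀ y ∈ centredBox d (ℓ (k + 1)), formalSchrodinger V f y = E * f y) {x : Lattice d}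
    (hx : 32 * ‖x‖ ≤ ℓ (k + 1)) {M : ℝ} (hM0 : 0 ≤ M)
    (hM : ∀ y ∈ centredBox d (ℓ (k + 1)), ‖f y‖ ≤ M) :
    ‖f x‖ ≤ Real.exp (-(m * ℓ k)) * M := by
  have hg := h.scales k
  have hL := hg.one_le
  have hLL' := hg.thousand_mul_le
  have hxj (j : Fin d) : 32 * |x j| ≤ ℓ (k + 1) := by
    have hnorm : ‖x j‖ ≤ ‖x‖ := norm_le_pi_norm x j
    rw [Int.norm_eq_abs] at hnorm
    exact_mod_cast (mul_le_mul_of_nonneg_left hnorm (by norm_num : (0 : ℝ) ≤ 32)).trans hx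
  have hdist : (ℓ k : ℝ) + (3 * J + 1) * ℓ k ≤ ((ℓ (k + 1) / 16 : ℕ) : ℝ) := by
    have := hg.mul_add_one_le
    exact_mod_cast (by omega : ℓ k + (3 * J + 1) * ℓ k ≤ ℓ (k + 1) / 16)
  calc ‖f x‖ ≤ Real.exp (-(m * ((ℓ (k + 1) / 16 : ℕ) - (3 * J + 1) * ℓ k))) * M := by
        refine hg.norm_apply_le hd hm (fun _ => by omega) (fun _ => by omega) hres
          (h.isSparse_centredBox hd k) (fun y hy => hf y ?_) (fun j => ?_) hM0
          fun y hy => hM y (mem_centredBox.2 fun j => ?_)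
        · have hy := (mem_centredBox_iff_norm_le (L := ℓ (k + 1) / 8)).1 hy
          exact mem_centredBox_iff_norm_le.2 (hy.trans (by exact_mod_cast Nat.div_le_self _ 8))
        · have := abs_le.1 (le_refl |x j|)
          have := hxj j
          omega
        · have := hy j
          rw [abs_le]
          omega
    _ ≤ Real.exp (-(m * ℓ k)) * M := by
        gcongr
        linarith

lemma exists_not_isResonant_rectangle (hres : IsCentrallyResonant V m b J E ℓ k) {y : Lattice d}
    {i : Fin d} (hi : ∀ j, |y j| ≤ |y i|) {δ : ℕ} (hδ : 2 * δ ≤ ℓ (k + 1))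
    (hy : (ℓ (k + 1) / 8 : ℕ) + 1 + δ ≤ |y i|) (hy' : |y i| + ℓ (k + 1) ≤ ℓ (k + 2)) :
    ∃ t : ℤ, (t + δ ≤ y i ∧ y i + δ ≤ t + ℓ (k + 1)) ∧
      rectangle y i t (ℓ (k + 1)) ⊆ centredBox d (ℓ (k + 2)) ∧
      ¬ IsResonant V m b J E (ℓ k) (rectangle y i t (ℓ (k + 1))) := by
  have hL'' : ℓ (k + 1) ≤ ℓ (k + 2) := (h.scales (k + 1)).le
  obtain ⟨t₀, t, ⟨ht₀, ht₀'⟩, ht, hdisj⟩ :=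
    exists_disjoint_intervals (q := ℓ (k + 1) / 8) (by omega) hδ hy
  have hsub : rectangle y i t (ℓ (k + 1)) ⊆ centredBox d (ℓ (k + 2)) :=
    rectangle_subset_centredBox (by omega) (by omega) fun j => by have := hi j; omega
  have hsub₀ : rectangle 0 i t₀ (ℓ (k + 1)) ⊆ centredBox d (ℓ (k + 2)) :=
    rectangle_subset_centredBox (by rw [Pi.zero_apply]; omega) (by rw [Pi.zero_apply]; omega)
      fun j => by simpa using hL''
  have hres₀ := IsResonant.mono hres
    (centredBox_subset_rectangle (i := i) (Nat.div_le_self _ 8) ht₀ ht₀')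
  exact ⟨t, ht, hsub, fun hcon => (h.resonant k).notMem_of_disjoint
    ⟨isRectangle_rectangle, hres₀⟩ hsub₀ hsub (disjoint_rectangle hdisj)
    ⟨isRectangle_rectangle, hcon⟩⟩

lemma norm_apply_le_of_isCentrallyResonant (hd : 1 ≤ d) (hm : 0 ≤ m)
    (hres : IsCentrallyResonant V m b J E ℓ k)
    (hf : ∀ y ∈ centredBox d (ℓ (k + 2)), formalSchrodinger V f y = E * f y) {y : Lattice d}
    {δ : ℕ} (hδ : 2 * δ ≤ ℓ (k + 1)) (hy : (ℓ (k + 1) / 8 : ℕ) + 1 + δ ≤ ‖y‖)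
    (hy' : ‖y‖ + ℓ (k + 1) ≤ ℓ (k + 2)) {M : ℝ} (hM0 : 0 ≤ M)
    (hM : ∀ y', dist y' y ≤ ℓ (k + 1) + 1 → ‖f y'‖ ≤ M) :
    ‖f y‖ ≤ Real.exp (-(m * (δ - (3 * J + 1) * ℓ k))) * M := by
  have hg := h.scales k
  have hLL' := hg.thousand_mul_le
  obtain ⟨i, r, hi, hir, hr⟩ := exists_norm_eq hd y
  rw [hr] at hy hy'
  obtain ⟨t, ht, hsub, hnres⟩ := h.exists_not_isResonant_rectangle hres hi hδ
    (by rw [hir]; exact_mod_cast hy) (by rw [hir]; exact_mod_cast hy')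
  refine hg.norm_apply_le hd hm (fun j => ?_) (fun j => ?_) hnres
    (h.singular k _ isRectangle_rectangle) (fun w hw => hf w (hsub hw)) (fun j => ?_) hM0
    fun y' hy' => hM y' ?_
  · split_ifs <;> omega
  · split_ifs <;> omega
  · split_ifs with hj
    · subst hj
      exact ht
    · omega
  · have hdist : dist y' y ≤ (ℓ (k + 1) + 1 : ℕ) := dist_le_natCast_iff.2 fun j => by
      have := hy' j
      rw [abs_le]
      split_ifs at this with hj
      · subst hj
        omega
      · omega
    exact_mod_cast hdist

lemma norm_apply_le_exp_of_le_mul (hd : 1 ≤ d) (hm : 0 ≤ m)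
    (hres : IsCentrallyResonant V m b J E ℓ k)
    (hf : ∀ y ∈ centredBox d (ℓ (k + 2)), formalSchrodinger V f y = E * f y) {y : Lattice d}
    (hy : ℓ (k + 1) ≤ 4 * ‖y‖) (hy' : ‖y‖ ≤ 4 * ℓ (k + 1)) {M : ℝ} (hM0 : 0 ≤ M)
    (hM : ∀ y', ‖y'‖ ≤ 6 * ‖y‖ → ‖f y'‖ ≤ M) :
    ‖f y‖ ≤ Real.exp (-(m / 16 * ‖y‖)) * M := by
  have hL := (h.scales k).one_le
  have hLL' := (h.scales k).thousand_mul_le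
  have hnext : 1000 * ℓ (k + 1) ≤ ℓ (k + 2) := (h.scales (k + 1)).thousand_mul_le
  have hloss : (250 * ((3 * J + 1) * ℓ k + 1) : ℝ) ≤ ℓ (k + 1) := by
    exact_mod_cast (h.scales k).mul_add_one_le
  obtain ⟨-, r, -, -, hr⟩ := exists_norm_eq hd y
  have hrL : ℓ (k + 1) ≤ 4 * r := by rw [hr] at hy; exact_mod_cast hy
  have hrL' : r ≤ 4 * ℓ (k + 1) := by rw [hr] at hy'; exact_mod_cast hy'
  set δ := min (ℓ (k + 1) / 2) (r - ℓ (k + 1) / 8 - 1)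
  have hδr : (r : ℝ) ≤ 8 * δ + 8 := by exact_mod_cast (by omega : r ≤ 8 * δ + 8)
  calc ‖f y‖ ≤ Real.exp (-(m * (δ - (3 * J + 1) * ℓ k))) * M := by
        refine h.norm_apply_le_of_isCentrallyResonant hd hm hres hf (by omega) ?_ ?_ hM0
          fun y' hy' => hM y' ?_
        · rw [hr]
          exact_mod_cast (by omega : ℓ (k + 1) / 8 + 1 + δ ≤ r)
        · rw [hr]
          exact_mod_cast (by omega : r + ℓ (k + 1) ≤ ℓ (k + 2))
        · have hL' : (1 : ℝ) ≤ ‖y‖ := by rw [hr]; exact_mod_cast (by omega : 1 ≤ r)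
          linarith [norm_sub_norm_le y' y, dist_eq_norm y' y]
    _ ≤ Real.exp (-(m / 16 * ‖y‖)) * M := by
        rw [div_mul_eq_mul_div, mul_div_assoc]
        gcongr
        linarith

lemma norm_apply_le_exp_of_mul_le (hd : 1 ≤ d) (hm : 0 ≤ m)
    (hres : IsCentrallyResonant V m b J E ℓ k)
    (hf : ∀ y ∈ centredBox d (ℓ (k + 2)), formalSchrodinger V f y = E * f y) {y : Lattice d}
    (hy : 4 * ℓ (k + 1) ≤ ‖y‖) (hy' : 4 * ‖y‖ ≤ ℓ (k + 2)) {M : ℝ} (hM0 : 0 ≤ M)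
    (hM : ∀ y', ‖y'‖ ≤ 6 * ‖y‖ → ‖f y'‖ ≤ M) :
    ‖f y‖ ≤ Real.exp (-(m / 16 * ‖y‖)) * M := by
  have hL := (h.scales k).one_le
  have hLL' := (h.scales k).thousand_mul_le
  have hL' : (1000 : ℝ) ≤ ℓ (k + 1) := by exact_mod_cast (by omega : 1000 ≤ ℓ (k + 1))
  have hnext : (1000 * ℓ (k + 1) : ℝ) ≤ ℓ (k + 2) := by
    exact_mod_cast (h.scales (k + 1)).thousand_mul_le
  have hhalf : ((ℓ (k + 1) / 2 : ℕ) : ℝ) ≤ ℓ (k + 1) / 2 := Nat.cast_div_le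
  have hradius : ((ℓ (k + 1) / 8 : ℕ) : ℝ) ≤ ℓ (k + 1) / 8 := Nat.cast_div_le
  -- As many steps of length `ℓ (k + 1) + 1` as keep at distance at least `‖y‖ / 2` from the origin.
  set n := ⌊‖y‖ / (2 * (ℓ (k + 1) + 1))⌋₊
  have hn : n * (2 * (ℓ (k + 1) + 1)) ≤ ‖y‖ :=
    (le_div_iff₀ (by positivity)).1 (Nat.floor_le (by positivity))
  have hn' : ‖y‖ < (n + 1) * (2 * (ℓ (k + 1) + 1)) :=
    (div_lt_iff₀ (by positivity)).1 (Nat.lt_floor_add_one _)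
  have hball {x : Lattice d} (hx : dist x y ≤ n * (ℓ (k + 1) + 1)) : |‖x‖ - ‖y‖| ≤ ‖y‖ / 2 := by
    have := abs_norm_sub_norm_le x y
    rw [← dist_eq_norm] at this
    linarith
  calc ‖f y‖ ≤ Real.exp (-(m * ((ℓ (k + 1) / 2 : ℕ) - (3 * J + 1) * ℓ k))) ^ n * M := by
        refine le_pow_mul_of_forall_dist_le (f := fun x => ‖f x‖) (D := ℓ (k + 1) + 1)
          (Real.exp_pos _).le hM0 (by positivity) n (fun x hx M' hM'0 hM' => ?_) fun x hx => ?_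
        · have := abs_le.1 (hball hx)
          exact h.norm_apply_le_of_isCentrallyResonant hd hm hres hf (by omega) (by linarith)
            (by linarith) hM'0 hM'
        · exact hM x (by linarith [abs_le.1 (hball hx)])
    _ ≤ Real.exp (-(m / 16 * ‖y‖)) * M := by
        rw [← Real.exp_nat_mul]
        gcongr
        have hrate : ‖y‖ / 16 ≤ n * (((ℓ (k + 1) / 2 : ℕ) : ℝ) - (3 * J + 1) * ℓ k) :=
          calc ‖y‖ / 16 ≤ n * (3 / 8 * ℓ (k + 1)) := by nlinarith
            _ ≤ _ := by gcongr; exact (h.scales k).mul_le_half_sub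
        linarith [mul_le_mul_of_nonneg_left hrate hm]

end SparseAtAllScales

end Scales

/-! ### Exponential decay of eigenfunctions -/

lemma exists_le_le_succ {α : Type*} [LinearOrder α] {u : ℕ → α} {t : α} {K n : ℕ} (hKn : K ≤ n)
    (hK : u K ≤ t) (hn : t ≤ u (n + 1)) : ∃ k, K ≤ k ∧ k ≤ n ∧ u k ≤ t ∧ t ≤ u (k + 1) := by
  induction n, hKn using Nat.le_induction with
  | base => exact ⟨K, le_rfl, le_rfl, hK, hn⟩
  | succ n hKn ih =>
    rcases le_total t (u (n + 1)) with ht | ht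
    · obtain ⟨k, hKk, hkn, hk⟩ := ih ht
      exact ⟨k, hKk, hkn.trans n.le_succ, hk⟩
    · exact ⟨n + 1, hKn.trans n.le_succ, le_rfl, ht, hn⟩

namespace SparseAtAllScales

variable {V : Lattice d → ℝ} {m b : ℝ} {J : ℕ} {E : ℝ} {ℓ : ℕ → ℕ}
  (h : SparseAtAllScales V m b J E ℓ) {f : Lattice d → ℂ}

include h

lemma monotone : Monotone ℓ :=
  monotone_nat_of_le_succ fun k => (h.scales k).le

lemma le_scale (k : ℕ) : k ≤ ℓ k := by
  induction k with
  | zero => exact Nat.zero_le _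
  | succ k ih => linarith [(h.scales k).thousand_mul_le, (h.scales k).one_le]

lemma norm_apply_le_exp_of_forall (hd : 1 ≤ d) (hm : 0 ≤ m) {K n : ℕ} (hKn : K ≤ n)
    (hres : ∀ k, K ≤ k → k ≤ n → IsCentrallyResonant V m b J E ℓ k)
    (hf : ∀ y ∈ centredBox d (ℓ (n + 2)), formalSchrodinger V f y = E * f y) {y : Lattice d}
    (hy : ℓ (K + 1) ≤ 4 * ‖y‖) (hy' : 4 * ‖y‖ ≤ ℓ (n + 2)) {M : ℝ} (hM0 : 0 ≤ M)
    (hM : ∀ y', ‖y'‖ ≤ 6 * ‖y‖ → ‖f y'‖ ≤ M) :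
    ‖f y‖ ≤ Real.exp (-(m / 16 * ‖y‖)) * M := by
  obtain ⟨k, hKk, hkn, hk, hk'⟩ := exists_le_le_succ (u := fun k => (ℓ (k + 1) : ℝ)) hKn hy hy'
  have hfk (w : Lattice d) (hw : w ∈ centredBox d (ℓ (k + 2))) :
      formalSchrodinger V f w = E * f w := by
    refine hf w ?_
    rw [mem_centredBox_iff_norm_le] at hw ⊢
    exact hw.trans (by exact_mod_cast h.monotone (by omega : k + 2 ≤ n + 2))
  rcases le_total ‖y‖ (4 * ℓ (k + 1)) with hnear | hfar
  · exact h.norm_apply_le_exp_of_le_mul hd hm (hres k hKk hkn) hfk hk hnear hM0 hM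
  · exact h.norm_apply_le_exp_of_mul_le hd hm (hres k hKk hkn) hfk hfar hk' hM0 hM

lemma eventually_isCentrallyResonant (hd : 1 ≤ d) (hm : 0 < m)
    (hf : ∀ y, formalSchrodinger V f y = E * f y) {A : ℝ} (hA : ∀ y, ‖f y‖ ≤ A) {x : Lattice d}
    (hx : f x ≠ 0) : ∀ᶠ k in atTop, IsCentrallyResonant V m b J E ℓ k := by
  have hA0 : 0 ≤ A := (norm_nonneg (f x)).trans (hA x)
  have hlim : Tendsto (fun k : ℕ => Real.exp (-(m * k)) * A) atTop (𝓝 0) := by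
    simpa using (Real.tendsto_exp_neg_atTop_nhds_zero.comp
      (tendsto_natCast_atTop_atTop.const_mul_atTop hm)).mul_const A
  filter_upwards [hlim.eventually (gt_mem_nhds (norm_pos_iff.2 hx)),
    tendsto_natCast_atTop_atTop.eventually_ge_atTop (32 * ‖x‖)] with k hsmall hk
  by_contra hres
  have hkℓ : (k : ℝ) ≤ ℓ k := by exact_mod_cast h.le_scale k
  have hkℓ' : (k : ℝ) ≤ ℓ (k + 1) := hkℓ.trans (by exact_mod_cast h.monotone k.le_succ)
  refine hsmall.not_ge ?_
  calc ‖f x‖ ≤ Real.exp (-(m * ℓ k)) * A :=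
        h.norm_apply_le_of_not_isCentrallyResonant hd hm.le hres (fun y _ => hf y)
          (hk.trans hkℓ') hA0 fun y _ => hA y
    _ ≤ Real.exp (-(m * k)) * A := by gcongr

lemma exists_norm_mul_exp_le (hd : 1 ≤ d) (hm : 0 < m)
    (hf : ∀ y, formalSchrodinger V f y = E * f y) {A : ℝ} (hA : ∀ y, ‖f y‖ ≤ A) {x : Lattice d}
    (hx : f x ≠ 0) : ∃ C : ℝ, ∀ y, ‖f y‖ * Real.exp (m / 16 * ‖y‖) ≤ C := by
  have hA0 : 0 ≤ A := (norm_nonneg (f x)).trans (hA x)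
  obtain ⟨K, hK⟩ := eventually_atTop.1 (h.eventually_isCentrallyResonant hd hm hf hA hx)
  refine ⟨A * Real.exp (m / 16 * ℓ (K + 1)), fun y => ?_⟩
  rcases le_total ((ℓ (K + 1) : ℝ)) (4 * ‖y‖) with hy | hy
  · obtain ⟨n, hn⟩ := exists_nat_ge (4 * ‖y‖)
    have hscale : (n : ℝ) ≤ ℓ (max n K + 2) := by
      exact_mod_cast (h.le_scale n).trans (h.monotone (by omega))
    have hdecay := h.norm_apply_le_exp_of_forall hd hm.le (le_max_right n K)
      (fun k hk _ => hK k hk) (fun y _ => hf y) hy (hn.trans hscale) hA0 fun y' _ => hA y'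
    calc ‖f y‖ * Real.exp (m / 16 * ‖y‖)
        ≤ Real.exp (-(m / 16 * ‖y‖)) * A * Real.exp (m / 16 * ‖y‖) := by gcongr
      _ = A * 1 := by
        rw [mul_right_comm, ← Real.exp_add, neg_add_cancel, Real.exp_zero, mul_comm]
      _ ≤ _ := by
        gcongr
        exact Real.one_le_exp (by positivity)
  · gcongr
    · exact hA y
    · linarith [norm_nonneg y]

end SparseAtAllScales

lemma hasSum_sub_apply_sub {G α : Type*} [AddGroup G] [AddCommGroup α] [TopologicalSpace α]
    [IsTopologicalAddGroup α] {g : G → α} (hg : Summable g) (e : G) :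
    HasSum (fun x => g x - g (x - e)) 0 := by
  simpa using hg.hasSum.sub ((Equiv.hasSum_iff (Equiv.subRight e)).2 hg.hasSum)

lemma summable_conj_mul_shift {f : Lattice d → ℂ} (hf : Summable fun x => ‖f x‖ ^ 2)
    (e : Lattice d) : Summable fun x => conj (f x) * f (x + e) := by
  have hshift : Summable fun x => ‖f (x + e)‖ ^ 2 := hf.comp_injective (add_left_injective e)
  refine Summable.of_norm_bounded (hf.add hshift) fun x => ?_
  rw [norm_mul, RCLike.norm_conj]
  nlinarith [two_mul_le_add_sq ‖f x‖ ‖f (x + e)‖, sq_nonneg ‖f x‖, sq_nonneg ‖f (x + e)‖]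

-- The imaginary part of `conj f * H f` is a discrete divergence, so it sums to zero.
lemma im_eq_zero_of_summable {V : Lattice d → ℝ} {f : Lattice d → ℂ}
    (hf : Summable fun x => ‖f x‖ ^ 2) {x₀ : Lattice d} (hx₀ : f x₀ ≠ 0) {E : ℂ}
    (hE : ∀ x, formalSchrodinger V f x = E * f x) : E.im = 0 := by
  let current (i : Fin d) (x : Lattice d) : ℝ := (conj (f x) * f (x + Pi.single i 1)).im
  have hcurrent (i : Fin d) : Summable (current i) :=
    Complex.imCLM.summable (summable_conj_mul_shift hf _)
  have hdiv (x : Lattice d) :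
      E.im * ‖f x‖ ^ 2 = ∑ i, (current i x - current i (x - Pi.single i 1)) := by
    have himE : (conj (f x) * formalSchrodinger V f x).im = E.im * ‖f x‖ ^ 2 := by
      rw [hE, mul_left_comm, mul_comm (conj (f x)), Complex.mul_conj, Complex.normSq_eq_norm_sq,
        Complex.im_mul_ofReal]
    have hV : (conj (f x) * ((V x : ℂ) * f x)).im = 0 := by
      rw [mul_left_comm, mul_comm (conj (f x)), Complex.mul_conj, ← Complex.ofReal_mul,
        Complex.ofReal_im]
    rw [← himE, formalSchrodinger_apply, mul_add, Complex.add_im, Finset.mul_sum, Complex.im_sum,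
      hV, add_zero]
    refine Finset.sum_congr rfl fun i _ => ?_
    simp only [current, sub_add_cancel, mul_add, Complex.add_im, Complex.mul_im, Complex.conj_re,
      Complex.conj_im]
    ring
  have hsum : HasSum (fun x => E.im * ‖f x‖ ^ 2) 0 := by
    simp only [hdiv]
    simpa using hasSum_sum fun i (_ : i ∈ Finset.univ) =>
      hasSum_sub_apply_sub (hcurrent i) (Pi.single i 1)
  have hpos : 0 < ∑' x, ‖f x‖ ^ 2 := hf.tsum_pos (fun x => by positivity) x₀ (by positivity)
  exact (mul_eq_zero.1 ((hf.hasSum.mul_left E.im).unique hsum)).resolve_right hpos.ne'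

lemma isEigenfunction_schrodinger_iff {V : Lattice d → ℝ} {ψ : Ell2 d} :
    IsEigenfunction (schrodinger V) ψ ↔
      ψ ≠ 0 ∧ ∃ E : ℂ, ∀ x, formalSchrodinger V ψ x = E * ψ x := by
  refine and_congr_right fun _ => exists_congr fun E => ⟨fun ⟨_, hE⟩ => ?_, fun hE => ?_⟩
  · exact fun x => by simpa [schrodinger] using congrArg (fun g : Ell2 d => g x) hE
  · have hfun : formalSchrodinger V ψ = E • (ψ : Lattice d → ℂ) := funext fun x => by simp [hE]
    have hmem : ψ ∈ (schrodinger V).domain := by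
      change Memℓp (formalSchrodinger V ψ) 2
      rw [hfun]
      exact (lp.memℓp ψ).const_smul E
    exact ⟨hmem, lp.ext hfun⟩

lemma exists_norm_mul_exp_le_of_isEigenfunction (hd : 1 ≤ d) {V : Lattice d → ℝ} {m b : ℝ} {J : ℕ}
    {ℓ : ℕ → ℕ} (hm : 0 < m) (h : ∀ E : ℝ, SparseAtAllScales V m b J E ℓ) {ψ : Ell2 d}
    (hψ : IsEigenfunction (schrodinger V) ψ) :
    ∃ C : ℝ, ∀ x : Lattice d, ‖ψ x‖ * Real.exp (m / 16 * ‖x‖) ≤ C := by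
  obtain ⟨hψ0, E, hE⟩ := isEigenfunction_schrodinger_iff.1 hψ
  obtain ⟨x, hx⟩ : ∃ x, ψ x ≠ 0 := by
    contrapose! hψ0
    exact lp.ext (funext hψ0)
  have hsum : Summable fun x => ‖ψ x‖ ^ 2 := by
    simpa using (lp.memℓp ψ).summable (by norm_num)
  lift E to ℝ using im_eq_zero_of_summable hsum hx hE
  exact (h E).exists_norm_mul_exp_le hd hm hE (lp.norm_apply_le_norm two_ne_zero ψ) hx

/-! ### Limits of approximate eigenfunctions -/

section Localization

lemma summable_prod_apply {ι α : Type*} [Fintype ι] {g : α → ℝ} (hg0 : ∀ n, 0 ≤ g n)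
    (hg : Summable g) : Summable fun y : ι → α => ∏ i, g (y i) := by
  classical
  refine summable_of_sum_le (c := ∏ _i : ι, ∑' n, g n)
    (fun y => Finset.prod_nonneg fun i _ => hg0 _) fun s => ?_
  let t (i : ι) : Finset α := s.image fun y => y i
  have hst : s ⊆ Fintype.piFinset t := fun y hy =>
    Fintype.mem_piFinset.2 fun i => Finset.mem_image_of_mem _ hy
  calc ∑ y ∈ s, ∏ i, g (y i) ≤ ∑ y ∈ Fintype.piFinset t, ∏ i, g (y i) :=
        Finset.sum_le_sum_of_subset_of_nonneg hst fun y _ _ => Finset.prod_nonneg fun i _ => hg0 _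
    _ = ∏ i, ∑ n ∈ t i, g n := (Finset.prod_univ_sum t fun _ n => g n).symm
    _ ≤ _ := Finset.prod_le_prod (fun i _ => Finset.sum_nonneg fun n _ => hg0 n)
        fun i _ => hg.sum_le_tsum _ fun n _ => hg0 n

lemma summable_exp_neg_mul_abs {c : ℝ} (hc : 0 < c) :
    Summable fun n : ℤ => Real.exp (-(c * |(n : ℝ)|)) := by
  have hnat : Summable fun n : ℕ => Real.exp (-(c * n)) :=
    (Real.summable_exp_nat_mul_iff.2 (neg_lt_zero.2 hc)).congr fun n => by congr 1; ring
  refine Summable.of_nat_of_neg (hnat.congr fun n => ?_) (hnat.congr fun n => ?_) <;> simp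

lemma summable_exp_neg_mul_norm {c : ℝ} (hc : 0 < c) :
    Summable fun y : Lattice d => Real.exp (-(c * ‖y‖)) := by
  have hprod : Summable fun y : Lattice d => ∏ i, Real.exp (-(c / (d + 1) * |(y i : ℝ)|)) :=
    summable_prod_apply (g := fun n : ℤ => Real.exp (-(c / (d + 1) * |(n : ℝ)|)))
      (fun _ => (Real.exp_pos _).le) (summable_exp_neg_mul_abs (by positivity))
  refine hprod.of_nonneg_of_le (fun y => (Real.exp_pos _).le) fun y => ?_
  rw [← Real.exp_sum, Finset.sum_neg_distrib]
  refine Real.exp_le_exp.2 (neg_le_neg ?_)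
  calc ∑ i, c / (d + 1) * |(y i : ℝ)| ≤ ∑ _i : Fin d, c / (d + 1) * ‖y‖ := by
        gcongr with i
        simpa only [Int.norm_eq_abs] using norm_le_pi_norm y i
    _ = d / (d + 1) * (c * ‖y‖) := by
        simp only [Finset.sum_const, Finset.card_univ, Fintype.card_fin, nsmul_eq_mul]
        ring
    _ ≤ c * ‖y‖ := mul_le_of_le_one_left (by positivity) ((div_le_one (by positivity)).2 (by simp))

lemma memℓp_of_norm_le_mul_exp {φ : Lattice d → ℂ} {A c : ℝ} (hc : 0 < c)
    (hφ : ∀ y, ‖φ y‖ ≤ A * Real.exp (-(c * ‖y‖))) : Memℓp φ 2 := by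
  have hone : Memℓp φ 1 := memℓp_gen <| by
    simpa using ((summable_exp_neg_mul_norm hc).mul_left A).of_nonneg_of_le
      (fun y => norm_nonneg (φ y)) hφ
  exact hone.of_exponent_ge one_le_two

lemma exists_tendsto_of_eventually_dist_le {X ι : Type*} [PseudoMetricSpace X] [ProperSpace X]
    (𝒰 : Ultrafilter ι) {u : ι → X} {x₀ : X} {A : ℝ}
    (hu : ∀ᶠ n in (𝒰 : Filter ι), dist (u n) x₀ ≤ A) :
    ∃ x, Tendsto u 𝒰 (𝓝 x) := by
  obtain ⟨x, -, hx⟩ := (isCompact_closedBall x₀ A).ultrafilter_le_nhds (𝒰.map u)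
    (le_principal_iff.2 hu)
  exact ⟨x, hx⟩

/-- An approximate eigenfunction of energy `E`: a solution on the box of radius `R` that decays
exponentially at rate `c` and does not become negligible on the box of radius `C`. The latter keeps
limits as `R → ∞` with `A`, `c` and `C` fixed from vanishing. -/
structure IsApproxEigenfunction (V : Lattice d → ℝ) (A c : ℝ) (C R : ℕ) (E : ℝ)
    (u : Lattice d → ℂ) : Prop where
  norm_le : ∀ y, ‖u y‖ ≤ A * Real.exp (-(c * ‖y‖))
  eq : ∀ y ∈ centredBox d R, formalSchrodinger V u y = E * u y
  exists_one_le : ∃ y ∈ centredBox d C, 1 ≤ ‖u y‖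

lemma centredBox_subset_centredBox {M N : ℕ} (h : M ≤ N) : centredBox d M ⊆ centredBox d N := by
  intro y hy
  rw [mem_centredBox_iff_norm_le] at hy ⊢
  exact hy.trans (by exact_mod_cast h)

lemma norm_formalSchrodinger_le (V : Lattice d → ℝ) {u : Lattice d → ℂ} {A : ℝ}
    (hu : ∀ y, ‖u y‖ ≤ A) (y : Lattice d) : ‖formalSchrodinger V u y‖ ≤ (2 * d + |V y|) * A := by
  rw [formalSchrodinger_apply]
  calc _ ≤ ∑ i : Fin d, (‖u (y + Pi.single i 1)‖ + ‖u (y - Pi.single i 1)‖) + |V y| * ‖u y‖ := by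
        refine (norm_add_le _ _).trans (add_le_add ?_ ?_)
        · exact (norm_sum_le _ _).trans (Finset.sum_le_sum fun i _ => norm_add_le _ _)
        · rw [norm_mul, Complex.norm_real, Real.norm_eq_abs]
    _ ≤ ∑ _i : Fin d, (A + A) + |V y| * A := by
        gcongr <;> exact hu _
    _ = _ := by
        simp only [Finset.sum_const, Finset.card_univ, Fintype.card_fin, nsmul_eq_mul]
        ring

lemma tendsto_formalSchrodinger {ι : Type*} {l : Filter ι} (V : Lattice d → ℝ)
    {u : ι → Lattice d → ℂ} {φ : Lattice d → ℂ} (hφ : ∀ y, Tendsto (fun n => u n y) l (𝓝 (φ y)))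
    (y : Lattice d) :
    Tendsto (fun n => formalSchrodinger V (u n) y) l (𝓝 (formalSchrodinger V φ y)) := by
  simp only [formalSchrodinger_apply]
  exact (tendsto_finsetSum _ fun i _ => (hφ _).add (hφ _)).add ((hφ y).const_mul _)

lemma tendsto_tsum_conj_mul {ι : Type*} {l : Filter ι} {u : ι → Lattice d → ℂ}
    {φ : Lattice d → ℂ} {A c : ℝ} (hc : 0 < c) (hu : ∀ n y, ‖u n y‖ ≤ A * Real.exp (-(c * ‖y‖)))
    (hφ : ∀ y, Tendsto (fun n => u n y) l (𝓝 (φ y))) (f : Ell2 d) :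
    Tendsto (fun n => ∑' y, conj (u n y) * f y) l (𝓝 (∑' y, conj (φ y) * f y)) := by
  refine tendsto_tsum_of_dominated_convergence
    (((summable_exp_neg_mul_norm hc).mul_left A).mul_right ‖f‖)
    (fun y => ((Complex.continuous_conj.tendsto _).comp (hφ y)).mul_const _)
    (Eventually.of_forall fun n y => ?_)
  rw [norm_mul, RCLike.norm_conj]
  exact mul_le_mul (hu n y) (lp.norm_apply_le_norm two_ne_zero f y) (norm_nonneg _)
    ((norm_nonneg _).trans (hu n y))

namespace IsApproxEigenfunction

variable {V : Lattice d → ℝ} {A c : ℝ} {C R : ℕ} {E : ℝ} {u : Lattice d → ℂ}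

lemma norm_apply_le (hu : IsApproxEigenfunction V A c C R E u) (hc : 0 ≤ c) (y : Lattice d) :
    ‖u y‖ ≤ A := by
  have hA : 0 ≤ A := nonneg_of_mul_nonneg_left ((norm_nonneg _).trans (hu.norm_le y))
    (Real.exp_pos _)
  exact (hu.norm_le y).trans (mul_le_of_le_one_right hA
    (Real.exp_le_one_iff.2 (neg_nonpos.2 (by positivity))))

lemma abs_energy_le (hu : IsApproxEigenfunction V A c C R E u) (hc : 0 ≤ c) (hCR : C ≤ R) :
    |E| ≤ (2 * d + ∑ y ∈ centredBox d C, |V y|) * A := by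
  obtain ⟨y, hy, hone⟩ := hu.exists_one_le
  have hA : 0 ≤ A := (norm_nonneg (u y)).trans (hu.norm_apply_le hc y)
  calc |E| ≤ |E| * ‖u y‖ := le_mul_of_one_le_right (abs_nonneg _) hone
    _ = ‖formalSchrodinger V u y‖ := by
        rw [hu.eq y (centredBox_subset_centredBox hCR hy), norm_mul, Complex.norm_real,
          Real.norm_eq_abs]
    _ ≤ (2 * d + |V y|) * A := norm_formalSchrodinger_le V (hu.norm_apply_le hc) y
    _ ≤ _ := by
        gcongr
        exact Finset.single_le_sum (f := fun y => |V y|) (fun _ _ => abs_nonneg _) hy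

lemma one_le_sum_norm (hu : IsApproxEigenfunction V A c C R E u) :
    1 ≤ ∑ y ∈ centredBox d C, ‖u y‖ := by
  obtain ⟨y, hy, hone⟩ := hu.exists_one_le
  exact hone.trans (Finset.single_le_sum (f := fun y => ‖u y‖) (fun _ _ => norm_nonneg _) hy)

-- Along an ultrafilter all values and energies converge at once, so no diagonal subsequence has to
-- be extracted.
lemma exists_tendsto {u : ℕ → Lattice d → ℂ} {E : ℕ → ℝ}
    (hu : ∀ R, IsApproxEigenfunction V A c C R (E R) (u R)) (hc : 0 ≤ c) (𝒰 : Ultrafilter ℕ)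
    (h𝒰 : (𝒰 : Filter ℕ) ≤ atTop) :
    ∃ (φ : Lattice d → ℂ) (E₀ : ℝ), (∀ y, Tendsto (fun R => u R y) 𝒰 (𝓝 (φ y))) ∧ φ ≠ 0 ∧
      ∀ y, formalSchrodinger V φ y = E₀ * φ y := by
  have hlim (y : Lattice d) : ∃ z, Tendsto (fun R => u R y) 𝒰 (𝓝 z) :=
    exists_tendsto_of_eventually_dist_le 𝒰 (x₀ := 0) (A := A)
      (Eventually.of_forall fun R => by simpa using (hu R).norm_apply_le hc y)
  choose φ hφ using hlim
  obtain ⟨E₀, hE₀⟩ := exists_tendsto_of_eventually_dist_le 𝒰 (u := E) (x₀ := 0)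
    (A := (2 * d + ∑ y ∈ centredBox d C, |V y|) * A) (by
      filter_upwards [h𝒰 (eventually_ge_atTop C)] with R hR
      simpa using (hu R).abs_energy_le hc hR)
  refine ⟨φ, E₀, hφ, ?_, fun y => ?_⟩
  · rintro rfl
    have hone : (1 : ℝ) ≤ ∑ y ∈ centredBox d C, ‖(0 : Lattice d → ℂ) y‖ :=
      ge_of_tendsto (tendsto_finsetSum _ fun y _ => (hφ y).norm)
        (Eventually.of_forall fun R => (hu R).one_le_sum_norm)
    simp only [Pi.zero_apply, norm_zero, Finset.sum_const_zero] at hone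
    exact not_lt.2 hone one_pos
  · obtain ⟨N, hN⟩ := exists_nat_ge ‖y‖
    have hEφ : Tendsto (fun R => (E R : ℂ) * u R y) 𝒰 (𝓝 (E₀ * φ y)) :=
      ((Complex.continuous_ofReal.tendsto E₀).comp hE₀).mul (hφ y)
    refine tendsto_nhds_unique ((tendsto_formalSchrodinger V hφ y).congr' ?_) hEφ
    filter_upwards [h𝒰 (eventually_ge_atTop N)] with R hR
    exact (hu R).eq y (mem_centredBox_iff_norm_le.2 (hN.trans (by exact_mod_cast hR)))

lemma exists_isEigenfunction_inner_ne_zero {f : Ell2 d} {δ : ℝ} (hc : 0 < c) (hδ : 0 < δ)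
    (h : ∀ R, ∃ (E : ℝ) (u : Lattice d → ℂ), IsApproxEigenfunction V A c C R E u ∧
      δ ≤ ‖∑' y, conj (u y) * f y‖) :
    ∃ ψ : Ell2 d, IsEigenfunction (schrodinger V) ψ ∧ inner ℂ ψ f ≠ 0 := by
  choose E u hu hδu using h
  obtain ⟨φ, E₀, hφ, hφ0, hE₀⟩ :=
    exists_tendsto hu hc.le (hyperfilter ℕ) Nat.hyperfilter_le_atTop
  have hφ_mem : Memℓp φ 2 := memℓp_of_norm_le_mul_exp hc fun y =>
    le_of_tendsto (hφ y).norm (Eventually.of_forall fun R => (hu R).norm_le y)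
  refine ⟨⟨φ, hφ_mem⟩, isEigenfunction_schrodinger_iff.2 ⟨fun h0 => hφ0 ?_, E₀, hE₀⟩, ?_⟩
  · exact congrArg (fun g : Ell2 d => (g : Lattice d → ℂ)) h0
  · have hinner : inner ℂ (⟨φ, hφ_mem⟩ : Ell2 d) f = ∑' y, conj (φ y) * f y := by
      simp only [lp.inner_eq_tsum, RCLike.inner_apply']
    have hδφ : δ ≤ ‖∑' y, conj (φ y) * f y‖ :=
      ge_of_tendsto (tendsto_tsum_conj_mul hc (fun R => (hu R).norm_le) hφ f).norm
        (Eventually.of_forall hδu)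
    rw [hinner]
    exact norm_pos_iff.1 (hδ.trans_le hδφ)

end IsApproxEigenfunction

end Localization

section BoxEigenfunction

variable (V : Lattice d → ℝ) (s : Finset (Lattice d))

/-- The eigenvalues of the restriction of the Schrödinger operator to `s`, with multiplicity. -/
def boxEigenvalue : s → ℝ := (restriction_isHermitian V s).eigenvalues

open Classical in
/-- An orthonormal eigenbasis of the restriction of the Schrödinger operator to `s`, extended by
zero to the whole lattice. -/
def boxEigenfunction (j : s) (y : Lattice d) : ℂ :=
  if h : y ∈ s then (restriction_isHermitian V s).eigenvectorBasis j ⟨y, h⟩ else 0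

/-- The coefficient of `g` along the `j`-th eigenfunction on `s`. -/
def boxCoeff (g : Lattice d → ℂ) (j : s) : ℂ := ∑ w ∈ s, conj (boxEigenfunction V s j w) * g w

variable {V s}

lemma boxEigenfunction_coe (j y : s) :
    boxEigenfunction V s j y = (restriction_isHermitian V s).eigenvectorBasis j y := by
  simp [boxEigenfunction]

lemma boxEigenfunction_of_notMem (j : s) {y : Lattice d} (hy : y ∉ s) :
    boxEigenfunction V s j y = 0 :=
  dif_neg hy

lemma boxCoeff_eq_inner (g : Lattice d → ℂ) (j : s) : boxCoeff V s g j =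
    inner ℂ ((restriction_isHermitian V s).eigenvectorBasis j)
      (WithLp.toLp 2 fun y : s => g y) := by
  rw [boxCoeff, PiLp.inner_apply, ← Finset.sum_coe_sort s]
  simp only [boxEigenfunction_coe, RCLike.inner_apply']

lemma formalSchrodinger_boxEigenfunction (j : s) {y : Lattice d} (hy : y ∈ s) :
    formalSchrodinger V (boxEigenfunction V s j) y =
      boxEigenvalue V s j * boxEigenfunction V s j y := by
  have hmulVec := restriction_mulVec V s (boxEigenfunction V s j) ⟨y, hy⟩
  have hind : (s : Set (Lattice d)).indicator (boxEigenfunction V s j) = boxEigenfunction V s j :=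
    Set.indicator_eq_self.2 fun w hw => by
      contrapose! hw
      exact Function.notMem_support.2 (boxEigenfunction_of_notMem j hw)
  simp only [hind, boxEigenfunction_coe] at hmulVec
  rw [← hmulVec, boxEigenfunction_coe j ⟨y, hy⟩]
  exact congrFun ((restriction_isHermitian V s).mulVec_eigenvectorBasis j) ⟨y, hy⟩

lemma eq_sum_boxCoeff_mul (g : Lattice d → ℂ) {y : Lattice d} (hy : y ∈ s) :
    g y = ∑ j, boxCoeff V s g j * boxEigenfunction V s j y := by
  have hrepr := congrArg (fun v : EuclideanSpace ℂ s => v ⟨y, hy⟩)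
    ((restriction_isHermitian V s).eigenvectorBasis.sum_repr' (WithLp.toLp 2 fun y : s => g y))
  simp only [WithLp.ofLp_sum, Finset.sum_apply, WithLp.ofLp_smul, Pi.smul_apply, smul_eq_mul,
    ← boxCoeff_eq_inner, ← boxEigenfunction_coe] at hrepr
  exact hrepr.symm

lemma sum_norm_sq_boxCoeff (g : Lattice d → ℂ) :
    ∑ j, ‖boxCoeff V s g j‖ ^ 2 = ∑ w ∈ s, ‖g w‖ ^ 2 := by
  simp only [boxCoeff_eq_inner]
  rw [OrthonormalBasis.sum_sq_norm_inner_right, EuclideanSpace.norm_sq_eq, ← Finset.sum_coe_sort s]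

lemma sum_norm_sq_boxEigenfunction_le_one (y : Lattice d) :
    ∑ j, ‖boxEigenfunction V s j y‖ ^ 2 ≤ 1 := by
  by_cases hy : y ∈ s
  · have hcoeff (j : s) :
        boxCoeff V s (Pi.single y 1) j = conj (boxEigenfunction V s j y) := by
      simp [boxCoeff, Pi.single_apply, hy]
    have hparseval := sum_norm_sq_boxCoeff (V := V) (s := s) (Pi.single y 1)
    simp only [hcoeff, RCLike.norm_conj] at hparseval
    rw [hparseval, Finset.sum_eq_single_of_mem y hy fun w _ hw => by simp [hw]]
    simp
  · simp [boxEigenfunction_of_notMem _ hy]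

lemma norm_boxEigenfunction_le_one (j : s) (y : Lattice d) : ‖boxEigenfunction V s j y‖ ≤ 1 := by
  have hsq := (Finset.single_le_sum (f := fun j => ‖boxEigenfunction V s j y‖ ^ 2)
    (fun j _ => by positivity) (Finset.mem_univ j)).trans (sum_norm_sq_boxEigenfunction_le_one y)
  simpa using hsq

end BoxEigenfunction

/-! ### Completeness -/

lemma GoodScales.card_centredBox_le_exp (hd : 1 ≤ d) {m b : ℝ} {J L L' : ℕ} (hm : 0 ≤ m)
    (h : GoodScales d m b J L L') : ((centredBox d L').card : ℝ) ≤ Real.exp (m * L) := by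
  refine le_trans ?_ (h.bondBound_le_exp hd hm)
  have htwo : (1 : ℝ) ≤ 2 * d := by
    have : (1 : ℝ) ≤ d := by exact_mod_cast hd
    linarith
  exact (le_mul_of_one_le_left (by positivity) htwo).trans
    (two_mul_card_Icc_le_bondBound fun _ => by ring_nf; exact le_rfl)

lemma exists_forall_norm_le_mul_exp {X F : Type*} [SeminormedAddGroup X] [SeminormedAddGroup F]
    {f : X → F} {s : Finset X} (hf : ∀ y ∉ s, ‖f y‖ = 0) (c : ℝ) :
    ∃ z, ∀ y, ‖f y‖ ≤ ‖f z‖ * Real.exp (-(c * ‖z‖)) * Real.exp (c * ‖y‖) := by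
  rcases s.eq_empty_or_nonempty with rfl | hs
  · exact ⟨0, fun y => by rw [hf y (Finset.notMem_empty y)]; positivity⟩
  · obtain ⟨z, -, hz⟩ := s.exists_max_image (fun y => ‖f y‖ * Real.exp (-(c * ‖y‖))) hs
    refine ⟨z, fun y => ?_⟩
    by_cases hy : y ∈ s
    · calc ‖f y‖ = ‖f y‖ * Real.exp (-(c * ‖y‖)) * Real.exp (c * ‖y‖) := by
            rw [mul_assoc, ← Real.exp_add, neg_add_cancel, Real.exp_zero, mul_one]
        _ ≤ _ := by
            exact mul_le_mul_of_nonneg_right (hz y hy) (Real.exp_pos _).le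
    · rw [hf y hy]
      positivity

namespace SparseAtAllScales

variable {V : Lattice d → ℝ} {m b : ℝ} {J : ℕ} {E : ℝ} {ℓ : ℕ → ℕ}
  (h : SparseAtAllScales V m b J E ℓ) {f : Lattice d → ℂ} {K n : ℕ}

include h

-- The growth rate `m / 192` is tuned so that `6 * (m / 192) = m / 32` is half of the decay rate
-- `m / 16`.
lemma norm_apply_le_mul_exp_of_le_mul_exp (hd : 1 ≤ d) (hm : 0 ≤ m) (hKn : K ≤ n)
    (hres : ∀ k, K ≤ k → k ≤ n → IsCentrallyResonant V m b J E ℓ k)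
    (hf : ∀ y ∈ centredBox d (ℓ (n + 2)), formalSchrodinger V f y = E * f y) {W : ℝ} (hW : 0 ≤ W)
    (hfW : ∀ y, ‖f y‖ ≤ W * Real.exp (m / 192 * ‖y‖)) {y : Lattice d}
    (hy : ℓ (K + 1) ≤ 4 * ‖y‖) (hy' : 4 * ‖y‖ ≤ ℓ (n + 2)) :
    ‖f y‖ ≤ W * Real.exp (-(m / 32 * ‖y‖)) :=
  calc ‖f y‖ ≤ Real.exp (-(m / 16 * ‖y‖)) * (W * Real.exp (m / 192 * (6 * ‖y‖))) := by
        refine h.norm_apply_le_exp_of_forall hd hm hKn hres hf hy hy' (by positivity)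
          fun y' hy' => (hfW y').trans ?_
        gcongr
    _ = W * Real.exp (-(m / 32 * ‖y‖)) := by
        rw [mul_left_comm, ← Real.exp_add]
        ring_nf

lemma four_mul_norm_lt_of_maximal (hd : 1 ≤ d) (hm : 0 < m) (hKn : K ≤ n)
    (hres : ∀ k, K ≤ k → k ≤ n → IsCentrallyResonant V m b J E ℓ k)
    (hf : ∀ y ∈ centredBox d (ℓ (n + 2)), formalSchrodinger V f y = E * f y)
    (hf1 : ∀ y, ‖f y‖ ≤ 1) {z : Lattice d}
    (hz : ∀ y, ‖f y‖ ≤ ‖f z‖ * Real.exp (-(m / 192 * ‖z‖)) * Real.exp (m / 192 * ‖y‖))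
    (hlarge : Real.exp (-(m / 192 * (ℓ (n + 2) / 4))) < ‖f z‖ * Real.exp (-(m / 192 * ‖z‖))) :
    4 * ‖z‖ < ℓ (K + 1) := by
  by_contra! hKz
  rcases le_or_gt (4 * ‖z‖) (ℓ (n + 2)) with hzn | hzn
  · have hz0 : 0 < ‖z‖ := by
      have : (1 : ℝ) ≤ ℓ (K + 1) := by exact_mod_cast (h.scales (K + 1)).one_le
      linarith
    have hfz : 0 < ‖f z‖ := pos_of_mul_pos_left ((Real.exp_pos _).trans hlarge) (Real.exp_pos _).le
    have hdecay := h.norm_apply_le_mul_exp_of_le_mul_exp hd hm.le hKn hres hf (by positivity) hz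
      hKz hzn
    rw [mul_assoc, ← Real.exp_add] at hdecay
    refine (mul_lt_of_lt_one_right hfz (Real.exp_lt_one_iff.2 ?_)).not_ge hdecay
    have := mul_pos hm hz0
    linarith
  · refine hlarge.not_ge ?_
    calc ‖f z‖ * Real.exp (-(m / 192 * ‖z‖)) ≤ 1 * Real.exp (-(m / 192 * (ℓ (n + 2) / 4))) := by
          gcongr
          · exact hf1 z
          · linarith
      _ = _ := one_mul _

-- The decay constants do not depend on `n`. Comparing `f` with its weighted maximum, rather than
-- with `1`, is what makes this possible: the maximum is attained near the origin.
lemma norm_apply_le_exp_mul_exp (hd : 1 ≤ d) (hm : 0 < m) (hKn : K ≤ n)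
    (hres : ∀ k, K ≤ k → k ≤ n → IsCentrallyResonant V m b J E ℓ k)
    (hf : ∀ y ∈ centredBox d (ℓ (n + 2)), formalSchrodinger V f y = E * f y)
    (hf1 : ∀ y, ‖f y‖ ≤ 1) (hf0 : ∀ y ∉ centredBox d (ℓ (n + 2)), f y = 0) {x : Lattice d}
    (hx : Real.exp (-(m / 192 * (ℓ (n + 2) / 4))) < ‖f x‖ * Real.exp (-(m / 192 * ‖x‖))) {a : ℝ}
    (ha : ∀ y ∈ centredBox d (ℓ (K + 1)), ‖f y‖ ≤ a) {y : Lattice d} (hy : 4 * ‖y‖ ≤ ℓ (n + 2)) :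
    ‖f y‖ ≤ a * (Real.exp (m / 32 * ℓ (K + 1)) * Real.exp (-(m / 32 * ‖y‖))) := by
  obtain ⟨z, hz⟩ := exists_forall_norm_le_mul_exp (fun y hy => norm_eq_zero.2 (hf0 y hy)) (m / 192)
  set W := ‖f z‖ * Real.exp (-(m / 192 * ‖z‖))
  have hxW : ‖f x‖ * Real.exp (-(m / 192 * ‖x‖)) ≤ W := by
    rw [Real.exp_neg, ← div_eq_mul_inv, div_le_iff₀ (Real.exp_pos _)]
    exact hz x
  have hzK : 4 * ‖z‖ < ℓ (K + 1) :=
    h.four_mul_norm_lt_of_maximal hd hm hKn hres hf hf1 hz (hx.trans_le hxW)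
  have hWa : W ≤ a := by
    refine le_trans ?_ (ha z (mem_centredBox_iff_norm_le.2 (by linarith [norm_nonneg z])))
    refine mul_le_of_le_one_right (norm_nonneg _) (Real.exp_le_one_iff.2 (neg_nonpos.2 ?_))
    positivity
  have hW0 : 0 ≤ W := by positivity
  rcases le_total (ℓ (K + 1) : ℝ) (4 * ‖y‖) with hKy | hyK
  · refine (h.norm_apply_le_mul_exp_of_le_mul_exp hd hm.le hKn hres hf hW0 hz hKy hy).trans ?_
    gcongr
    · exact hW0.trans hWa
    · exact le_mul_of_one_le_left (Real.exp_pos _).le (Real.one_le_exp (by positivity))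
  · refine (ha y (mem_centredBox_iff_norm_le.2 (by linarith [norm_nonneg y]))).trans ?_
    refine le_mul_of_one_le_right (hW0.trans hWa) ?_
    rw [← Real.exp_add, ← mul_neg, ← mul_add]
    refine Real.one_le_exp (mul_nonneg (by positivity) ?_)
    linarith [norm_nonneg y]

lemma norm_sq_apply_le_of_not_isCentrallyResonant (hd : 1 ≤ d) (hm : 0 ≤ m) {k : ℕ}
    (hres : ¬ IsCentrallyResonant V m b J E ℓ k)
    (hf : ∀ y ∈ centredBox d (ℓ (k + 1)), formalSchrodinger V f y = E * f y) {x : Lattice d}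
    (hx : 32 * ‖x‖ ≤ ℓ (k + 1)) :
    ‖f x‖ ^ 2 ≤ Real.exp (-(m * ℓ k)) ^ 2 * ∑ y ∈ centredBox d (ℓ (k + 1)), ‖f y‖ ^ 2 := by
  have hsum : 0 ≤ ∑ y ∈ centredBox d (ℓ (k + 1)), ‖f y‖ ^ 2 :=
    Finset.sum_nonneg fun y _ => by positivity
  rw [← Real.sq_sqrt hsum, ← mul_pow]
  gcongr
  exact h.norm_apply_le_of_not_isCentrallyResonant hd hm hres hf hx (Real.sqrt_nonneg _)
    fun y hy => Real.le_sqrt_of_sq_le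
      (Finset.single_le_sum (f := fun y => ‖f y‖ ^ 2) (fun y _ => by positivity) hy)

end SparseAtAllScales

section PurePoint

variable {V : Lattice d → ℝ} {m b : ℝ} {J : ℕ} {ℓ : ℕ → ℕ}

lemma sum_norm_sq_le_of_not_isCentrallyResonant (hd : 1 ≤ d) (hm : 0 ≤ m)
    (h : ∀ E : ℝ, SparseAtAllScales V m b J E ℓ) {k : ℕ} {ι : Type*} {T : Finset ι}
    {ψ : ι → Lattice d → ℂ} {E : ι → ℝ}
    (hψ : ∀ j ∈ T, ∀ y ∈ centredBox d (ℓ (k + 1)), formalSchrodinger V (ψ j) y = E j * ψ j y)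
    (hψ1 : ∀ y, ∑ j ∈ T, ‖ψ j y‖ ^ 2 ≤ 1)
    (hres : ∀ j ∈ T, ¬ IsCentrallyResonant V m b J (E j) ℓ k) {x : Lattice d}
    (hx : 32 * ‖x‖ ≤ ℓ (k + 1)) :
    ∑ j ∈ T, ‖ψ j x‖ ^ 2 ≤ Real.exp (-(m * k)) :=
  calc ∑ j ∈ T, ‖ψ j x‖ ^ 2
      ≤ ∑ j ∈ T, Real.exp (-(m * ℓ k)) ^ 2 * ∑ y ∈ centredBox d (ℓ (k + 1)), ‖ψ j y‖ ^ 2 :=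
        Finset.sum_le_sum fun j hj =>
          (h (E j)).norm_sq_apply_le_of_not_isCentrallyResonant hd hm (hres j hj) (hψ j hj) hx
    _ = Real.exp (-(m * ℓ k)) ^ 2 * ∑ y ∈ centredBox d (ℓ (k + 1)), ∑ j ∈ T, ‖ψ j y‖ ^ 2 := by
        rw [← Finset.mul_sum, Finset.sum_comm]
    _ ≤ Real.exp (-(m * ℓ k)) ^ 2 * (centredBox d (ℓ (k + 1))).card := by
        gcongr
        simpa using Finset.sum_le_card_nsmul _ _ 1 fun y (_ : y ∈ centredBox d (ℓ (k + 1))) => hψ1 y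
    _ ≤ Real.exp (-(m * ℓ k)) ^ 2 * Real.exp (m * ℓ k) := by
        gcongr
        exact ((h 0).scales k).card_centredBox_le_exp hd hm
    _ = Real.exp (-(m * ℓ k)) := by
        rw [sq, mul_assoc, ← Real.exp_add, neg_add_cancel, Real.exp_zero, mul_one]
    _ ≤ Real.exp (-(m * k)) := by
        gcongr
        exact (h 0).le_scale k

lemma sum_le_sum_sum_add_card_mul {ι κ : Type*} {w : ι → ℝ} (hw : ∀ j, 0 ≤ w j) {I : Finset κ}
    {U : κ → Finset ι} {T : Finset ι} {η : ℝ} (hη : 0 ≤ η)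
    (hT : ∀ j ∈ T, (∃ k ∈ I, j ∈ U k) ∨ w j ≤ η) :
    ∑ j ∈ T, w j ≤ ∑ k ∈ I, ∑ j ∈ U k, w j + T.card * η := by
  classical
  have hterm (j : ι) (hj : j ∈ T) : w j ≤ (∑ k ∈ I, if j ∈ U k then w j else 0) + η := by
    have hnonneg (k : κ) : 0 ≤ if j ∈ U k then w j else 0 := by
      split_ifs
      exacts [hw j, le_rfl]
    rcases hT j hj with ⟨k, hk, hjk⟩ | hsmall
    · have hsingle := Finset.single_le_sum (fun k _ => hnonneg k) hk
      rw [if_pos hjk] at hsingle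
      linarith
    · linarith [Finset.sum_nonneg fun k (_ : k ∈ I) => hnonneg k]
  calc ∑ j ∈ T, w j ≤ ∑ j ∈ T, ((∑ k ∈ I, if j ∈ U k then w j else 0) + η) :=
        Finset.sum_le_sum hterm
    _ = ∑ k ∈ I, ∑ j ∈ T with j ∈ U k, w j + T.card * η := by
        rw [Finset.sum_add_distrib, Finset.sum_comm]
        simp only [Finset.sum_filter, Finset.sum_const, nsmul_eq_mul]
    _ ≤ _ := by
        gcongr with k
        · exact fun j _ _ => hw j
        · exact fun j hj => (Finset.mem_filter.1 hj).2

open Classical in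
/-- The eigenfunctions on the box of the scale `n + 2` that the scales between `K` and `n` confine
to the vicinity of the origin, and that have weight at least `η` at `x`. -/
def localizedModes (V : Lattice d → ℝ) (m b : ℝ) (J : ℕ) (ℓ : ℕ → ℕ) (K n : ℕ) (x : Lattice d)
    (η : ℝ) : Finset (centredBox d (ℓ (n + 2))) :=
  {j | (∀ k, K ≤ k → k ≤ n → IsCentrallyResonant V m b J (boxEigenvalue V _ j) ℓ k) ∧
    η ≤ ‖boxEigenfunction V _ j x‖ ^ 2}

lemma mem_localizedModes {K n : ℕ} {x : Lattice d} {η : ℝ} {j : centredBox d (ℓ (n + 2))} :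
    j ∈ localizedModes V m b J ℓ K n x η ↔
      (∀ k, K ≤ k → k ≤ n → IsCentrallyResonant V m b J (boxEigenvalue V _ j) ℓ k) ∧
        η ≤ ‖boxEigenfunction V _ j x‖ ^ 2 := by
  simp only [localizedModes, Finset.mem_filter_univ]

open Classical in
lemma sum_compl_localizedModes_le (hd : 1 ≤ d) (hm : 0 ≤ m)
    (h : ∀ E : ℝ, SparseAtAllScales V m b J E ℓ) {K n : ℕ} {x : Lattice d} (hx : 32 * ‖x‖ ≤ K)
    {η : ℝ} (hη : 0 ≤ η) :
    ∑ j ∈ (localizedModes V m b J ℓ K n x η)ᶜ, ‖boxEigenfunction V _ j x‖ ^ 2 ≤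
      ∑ k ∈ Finset.Icc K n, Real.exp (-(m * k)) + (centredBox d (ℓ (n + 2))).card * η := by
  let U (k : ℕ) : Finset (centredBox d (ℓ (n + 2))) :=
    {j | ¬ IsCentrallyResonant V m b J (boxEigenvalue V _ j) ℓ k}
  have hU (k : ℕ) (hk : k ∈ Finset.Icc K n) :
      ∑ j ∈ U k, ‖boxEigenfunction V _ j x‖ ^ 2 ≤ Real.exp (-(m * k)) := by
    rw [Finset.mem_Icc] at hk
    have hsub := centredBox_subset_centredBox (d := d)
      ((h 0).monotone (show k + 1 ≤ n + 2 by omega))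
    have hKℓ : (K : ℝ) ≤ ℓ (k + 1) := by
      exact_mod_cast (hk.1.trans k.le_succ).trans ((h 0).le_scale (k + 1))
    exact sum_norm_sq_le_of_not_isCentrallyResonant hd hm h
      (fun j _ y hy => formalSchrodinger_boxEigenfunction j (hsub hy))
      (fun y => (Finset.sum_le_univ_sum_of_nonneg fun j => by positivity).trans
        (sum_norm_sq_boxEigenfunction_le_one y))
      (fun j hj => (Finset.mem_filter.1 hj).2) (hx.trans hKℓ)
  refine (sum_le_sum_sum_add_card_mul (I := Finset.Icc K n) (U := U) (fun j => by positivity) hη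
    fun j hj => ?_).trans ?_
  · rw [Finset.mem_compl, mem_localizedModes, not_and_or] at hj
    refine hj.imp (fun hj => ?_) fun hj => (not_le.1 hj).le
    push Not at hj
    obtain ⟨k, hKk, hkn, hk⟩ := hj
    exact ⟨k, Finset.mem_Icc.2 ⟨hKk, hkn⟩, Finset.mem_filter.2 ⟨Finset.mem_univ _, hk⟩⟩
  · gcongr
    · exact hU _ ‹_›
    · exact (Finset.card_le_univ _).trans_eq (Fintype.card_coe _)

end PurePoint

lemma eventually_forall_sum_Icc_lt {g : ℕ → ℝ} (hg : Summable g) {ε : ℝ} (hε : 0 < ε) :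
    ∀ᶠ K in atTop, ∀ n, ∑ k ∈ Finset.Icc K n, g k < ε := by
  obtain ⟨N, hN⟩ := hg.nat_tsum_vanishing (Iio_mem_nhds hε)
  filter_upwards [eventually_ge_atTop N] with K hK n
  have htail := hN (Finset.Icc K n) fun k hk => hK.trans (Finset.mem_Icc.1 hk).1
  rwa [Finset.tsum_subtype', Set.mem_Iio] at htail

lemma tendsto_pow_mul_exp_neg_mul (d : ℕ) {c : ℝ} (hc : 0 < c) :
    Tendsto (fun L : ℕ => (2 * (L : ℝ) + 1) ^ d * Real.exp (-(c * L))) atTop (𝓝 0) := by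
  have hpow : Tendsto (fun L : ℕ => 3 ^ d * ((L : ℝ) ^ d * Real.exp (-(c * L)))) atTop (𝓝 0) := by
    simpa [Function.comp_def] using ((tendsto_rpow_mul_exp_neg_mul_atTop_nhds_zero d c hc).comp
      tendsto_natCast_atTop_atTop).const_mul ((3 : ℝ) ^ d)
  refine squeeze_zero' (Eventually.of_forall fun L => by positivity) ?_ hpow
  filter_upwards [eventually_ge_atTop 1] with L hL
  have hL1 : (1 : ℝ) ≤ L := by exact_mod_cast hL
  rw [← mul_assoc, ← mul_pow]
  gcongr
  linarith

lemma eventually_exp_lt_sqrt_mul (d : ℕ) {c B ε : ℝ} (hc : 0 < c) (hB : 0 < B) (hε : 0 < ε) :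
    ∀ᶠ L : ℕ in atTop, Real.exp (-(c * (L / 4))) < √(ε / (2 * (L : ℝ) + 1) ^ d) * B := by
  filter_upwards [(tendsto_pow_mul_exp_neg_mul d (half_pos hc)).eventually
    (gt_mem_nhds (by positivity : 0 < ε * B ^ 2))] with L hL
  rw [← div_lt_iff₀ hB, Real.lt_sqrt (by positivity), lt_div_iff₀ (by positivity), div_pow,
    div_mul_eq_mul_div, div_lt_iff₀ (by positivity), ← Real.exp_nat_mul]
  convert! hL using 1
  rw [mul_comm]
  congr 2
  push_cast
  ring

section Truncation

variable {V : Lattice d → ℝ} {A c a E : ℝ} {C R N : ℕ}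

lemma formalSchrodinger_congr {f g : Lattice d → ℂ} {y : Lattice d}
    (h : ∀ w, ‖w‖ ≤ ‖y‖ + 1 → f w = g w) : formalSchrodinger V f y = formalSchrodinger V g y := by
  have hsingle (i : Fin d) : ‖(Pi.single i 1 : Lattice d)‖ = 1 := by
    rw [Pi.norm_single, norm_one]
  simp only [formalSchrodinger_apply]
  congr 1
  · refine Finset.sum_congr rfl fun i _ => ?_
    rw [h _ ((norm_add_le _ _).trans_eq (by rw [hsingle])),
      h _ ((norm_sub_le _ _).trans_eq (by rw [hsingle]))]
  · rw [h y (by linarith)]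

lemma isApproxEigenfunction_indicator_inv_smul (hA : 0 ≤ A) (hCN : C ≤ N) (hRN : R + 1 ≤ N)
    {ψ : Lattice d → ℂ} (hψ : ∀ y ∈ centredBox d R, formalSchrodinger V ψ y = E * ψ y) (ha : 0 < a)
    (hdecay : ∀ y ∈ centredBox d N, ‖ψ y‖ ≤ a * (A * Real.exp (-(c * ‖y‖)))) {z : Lattice d}
    (hz : z ∈ centredBox d C) (haz : a ≤ ‖ψ z‖) :
    IsApproxEigenfunction V A c C R E
      ((centredBox d N : Set (Lattice d)).indicator ((a : ℂ)⁻¹ • ψ)) := by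
  have hind {y : Lattice d} (hy : y ∈ centredBox d N) :
      (centredBox d N : Set (Lattice d)).indicator ((a : ℂ)⁻¹ • ψ) y = (a : ℂ)⁻¹ * ψ y :=
    Set.indicator_of_mem (Finset.mem_coe.2 hy) _
  have hnorm : ‖(a : ℂ)⁻¹‖ = a⁻¹ := by
    rw [norm_inv, Complex.norm_real, Real.norm_eq_abs, abs_of_pos ha]
  refine ⟨fun y => ?_, fun y hy => ?_, z, hz, ?_⟩
  · by_cases hy : y ∈ centredBox d N
    · rw [hind hy, norm_mul, hnorm, inv_mul_le_iff₀ ha]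
      exact hdecay y hy
    · rw [Set.indicator_of_notMem (by exact_mod_cast hy), norm_zero]
      positivity
  · have hRN' : (R : ℝ) + 1 ≤ N := by exact_mod_cast hRN
    have hy' := mem_centredBox_iff_norm_le.1 hy
    rw [formalSchrodinger_congr (g := (a : ℂ)⁻¹ • ψ) fun w hw =>
        hind (mem_centredBox_iff_norm_le.2 (by linarith)),
      map_smul, Pi.smul_apply, hψ y hy, hind (mem_centredBox_iff_norm_le.2 (by linarith)),
      smul_eq_mul, mul_left_comm]
  · rw [hind (centredBox_subset_centredBox hCN hz), norm_mul, hnorm, le_inv_mul_iff₀ ha, mul_one]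
    exact haz

lemma tsum_conj_indicator_smul_mul {s t : Finset (Lattice d)} (hst : s ⊆ t) (κ : ℂ) (j : t)
    (f : Lattice d → ℂ) :
    ∑' y, conj ((s : Set (Lattice d)).indicator (κ • boxEigenfunction V t j) y) * f y =
      conj κ * boxCoeff V t ((s : Set (Lattice d)).indicator f) j := by
  classical
  rw [boxCoeff, Finset.mul_sum, tsum_eq_sum (s := t)]
  · refine Finset.sum_congr rfl fun y _ => ?_
    by_cases hy : y ∈ s <;> simp [hy, mul_assoc]
  · intro y hy
    have hys : y ∉ s := fun hys => hy (hst hys)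
    simp [hys]

lemma norm_boxCoeff_indicator_le {L : ℕ} {δ : ℝ} {f : Lattice d → ℂ}
    (hR : ∀ (E : ℝ) (u : Lattice d → ℂ), IsApproxEigenfunction V A c C R E u →
      ‖∑' y, conj (u y) * f y‖ < δ)
    (hA : 0 ≤ A) (hCN : C ≤ N) (hRN : R + 1 ≤ N) (hNL : N ≤ L) {j : centredBox d L} (ha : 0 < a)
    (hdecay : ∀ y ∈ centredBox d N,
      ‖boxEigenfunction V _ j y‖ ≤ a * (A * Real.exp (-(c * ‖y‖)))) {z : Lattice d}
    (hz : z ∈ centredBox d C) (haz : a ≤ ‖boxEigenfunction V _ j z‖) :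
    ‖boxCoeff V _ ((centredBox d N : Set (Lattice d)).indicator f) j‖ ≤ a * δ := by
  have hsmall := hR _ _ (isApproxEigenfunction_indicator_inv_smul hA hCN hRN
    (fun y hy => formalSchrodinger_boxEigenfunction j
      (centredBox_subset_centredBox (by omega) hy)) ha hdecay hz haz)
  rw [tsum_conj_indicator_smul_mul (centredBox_subset_centredBox hNL), norm_mul, RCLike.norm_conj,
    norm_inv, Complex.norm_real, Real.norm_eq_abs, abs_of_pos ha, inv_mul_lt_iff₀ ha] at hsmall
  exact hsmall.le

lemma sum_norm_sq_boxCoeff_indicator_le {s t : Finset (Lattice d)} (f : Ell2 d) (T : Finset t) :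
    ∑ j ∈ T, ‖boxCoeff V t ((s : Set (Lattice d)).indicator f) j‖ ^ 2 ≤ ‖f‖ ^ 2 :=
  calc _ ≤ ∑ j, ‖boxCoeff V t ((s : Set (Lattice d)).indicator f) j‖ ^ 2 :=
        Finset.sum_le_univ_sum_of_nonneg fun j => by positivity
    _ = ∑ w ∈ t, ‖(s : Set (Lattice d)).indicator f w‖ ^ 2 := sum_norm_sq_boxCoeff _
    _ ≤ ∑ w ∈ t, ‖f w‖ ^ 2 := by
        gcongr
        exact norm_indicator_le_norm_self _ _
    _ ≤ ‖f‖ ^ 2 := by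
        simpa using lp.sum_rpow_le_norm_rpow (p := 2) (by norm_num) f t

end Truncation

section Completeness

variable {V : Lattice d → ℝ} {m b : ℝ} {J : ℕ} {ℓ : ℕ → ℕ}

lemma SparseAtAllScales.le_scale_div_four {E : ℝ} (h : SparseAtAllScales V m b J E ℓ) {K n : ℕ}
    (hKn : K ≤ n) : ℓ (K + 1) ≤ ℓ (n + 2) / 4 := by
  have hmono : ℓ (K + 1) ≤ ℓ (n + 1) := h.monotone (by omega)
  have hgap : 1000 * ℓ (n + 1) ≤ ℓ (n + 2) := (h.scales (n + 1)).thousand_mul_le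
  omega

lemma norm_boxCoeff_mul_norm_le_of_mem_localizedModes (hd : 1 ≤ d) (hm : 0 < m)
    (h : ∀ E : ℝ, SparseAtAllScales V m b J E ℓ) {f : Lattice d → ℂ} {K n R : ℕ} (hKn : K ≤ n)
    (hRn : 4 * (R + 1) ≤ ℓ (n + 2)) {δ : ℝ} (hδ : 0 ≤ δ)
    (hR : ∀ (E : ℝ) (u : Lattice d → ℂ),
      IsApproxEigenfunction V (Real.exp (m / 32 * ℓ (K + 1))) (m / 32) (ℓ (K + 1)) R E u →
        ‖∑' y, conj (u y) * f y‖ < δ)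
    {x : Lattice d} (hx : x ∈ centredBox d (ℓ (K + 1))) {η : ℝ}
    (hη : Real.exp (-(m / 192 * (ℓ (n + 2) / 4))) < √η * Real.exp (-(m / 192 * ‖x‖)))
    {j : centredBox d (ℓ (n + 2))} (hj : j ∈ localizedModes V m b J ℓ K n x η) :
    ‖boxCoeff V _ ((centredBox d (ℓ (n + 2) / 4) : Set (Lattice d)).indicator f) j‖ *
        ‖boxEigenfunction V _ j x‖ ≤
      δ * ∑ y ∈ centredBox d (ℓ (K + 1)), ‖boxEigenfunction V _ j y‖ ^ 2 := by
  obtain ⟨hres, hjx⟩ := mem_localizedModes.1 hj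
  have hηx : √η ≤ ‖boxEigenfunction V _ j x‖ := Real.sqrt_le_iff.2 ⟨norm_nonneg _, hjx⟩
  have hη0 : 0 < √η := pos_of_mul_pos_left ((Real.exp_pos _).trans hη) (Real.exp_pos _).le
  obtain ⟨z, hz, hmax⟩ := Finset.exists_max_image (centredBox d (ℓ (K + 1)))
    (fun y => ‖boxEigenfunction V _ j y‖) ⟨x, hx⟩
  have hxlarge := hη.trans_le (mul_le_mul_of_nonneg_right hηx (Real.exp_pos _).le)
  have hcoeff := norm_boxCoeff_indicator_le hR (Real.exp_pos _).le
    ((h 0).le_scale_div_four hKn) (by omega)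
    (Nat.div_le_self _ _) (hη0.trans_le (hηx.trans (hmax x hx)))
    (fun y hy => (h (boxEigenvalue V _ j)).norm_apply_le_exp_mul_exp hd hm hKn hres
      (fun y hy => formalSchrodinger_boxEigenfunction j hy) (norm_boxEigenfunction_le_one j)
      (fun y hy => boxEigenfunction_of_notMem j hy) hxlarge hmax ?_) hz le_rfl
  · calc _ ≤ ‖boxEigenfunction V _ j z‖ * δ * ‖boxEigenfunction V _ j z‖ := by
          gcongr
          exact hmax x hx
      _ = δ * ‖boxEigenfunction V _ j z‖ ^ 2 := by ring
      _ ≤ _ := by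
          gcongr
          exact Finset.single_le_sum (f := fun y => ‖boxEigenfunction V _ j y‖ ^ 2)
            (fun y _ => by positivity) hz
  · have hy := mem_centredBox_iff_norm_le.1 hy
    have : 4 * ((ℓ (n + 2) / 4 : ℕ) : ℝ) ≤ ℓ (n + 2) := by exact_mod_cast Nat.mul_div_le _ _
    linarith

lemma sum_localizedModes_le (hd : 1 ≤ d) (hm : 0 < m)
    (h : ∀ E : ℝ, SparseAtAllScales V m b J E ℓ) {f : Lattice d → ℂ} {K n R : ℕ} (hKn : K ≤ n)
    (hRn : 4 * (R + 1) ≤ ℓ (n + 2)) {δ : ℝ} (hδ : 0 ≤ δ)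
    (hR : ∀ (E : ℝ) (u : Lattice d → ℂ),
      IsApproxEigenfunction V (Real.exp (m / 32 * ℓ (K + 1))) (m / 32) (ℓ (K + 1)) R E u →
        ‖∑' y, conj (u y) * f y‖ < δ)
    {x : Lattice d} (hx : x ∈ centredBox d (ℓ (K + 1))) {η : ℝ}
    (hη : Real.exp (-(m / 192 * (ℓ (n + 2) / 4))) < √η * Real.exp (-(m / 192 * ‖x‖))) :
    ∑ j ∈ localizedModes V m b J ℓ K n x η,
        ‖boxCoeff V _ ((centredBox d (ℓ (n + 2) / 4) : Set (Lattice d)).indicator f) j‖ *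
          ‖boxEigenfunction V _ j x‖ ≤
      δ * (centredBox d (ℓ (K + 1))).card :=
  calc _ ≤ ∑ j ∈ localizedModes V m b J ℓ K n x η,
          δ * ∑ y ∈ centredBox d (ℓ (K + 1)), ‖boxEigenfunction V _ j y‖ ^ 2 :=
        Finset.sum_le_sum fun _ =>
          norm_boxCoeff_mul_norm_le_of_mem_localizedModes hd hm h hKn hRn hδ hR hx hη
    _ ≤ ∑ j, δ * ∑ y ∈ centredBox d (ℓ (K + 1)), ‖boxEigenfunction V _ j y‖ ^ 2 :=
        Finset.sum_le_univ_sum_of_nonneg fun j => by positivity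
    _ = δ * ∑ y ∈ centredBox d (ℓ (K + 1)), ∑ j, ‖boxEigenfunction V _ j y‖ ^ 2 := by
        rw [← Finset.mul_sum, Finset.sum_comm]
    _ ≤ _ := by
        gcongr
        simpa using Finset.sum_le_card_nsmul _ _ 1 fun y (_ : y ∈ centredBox d (ℓ (K + 1))) =>
          sum_norm_sq_boxEigenfunction_le_one y

open Classical in
lemma norm_apply_le_of_forall_isApproxEigenfunction (hd : 1 ≤ d) (hm : 0 < m)
    (h : ∀ E : ℝ, SparseAtAllScales V m b J E ℓ) {f : Ell2 d} {K n R : ℕ} (hKn : K ≤ n)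
    (hRn : 4 * (R + 1) ≤ ℓ (n + 2)) {δ : ℝ} (hδ : 0 ≤ δ)
    (hR : ∀ (E : ℝ) (u : Lattice d → ℂ),
      IsApproxEigenfunction V (Real.exp (m / 32 * ℓ (K + 1))) (m / 32) (ℓ (K + 1)) R E u →
        ‖∑' y, conj (u y) * f y‖ < δ)
    {x : Lattice d} (hx : 32 * ‖x‖ ≤ K) {η : ℝ} (hη0 : 0 ≤ η)
    (hη : Real.exp (-(m / 192 * (ℓ (n + 2) / 4))) < √η * Real.exp (-(m / 192 * ‖x‖))) :
    ‖f x‖ ≤ ‖f‖ * √(∑ k ∈ Finset.Icc K n, Real.exp (-(m * k)) +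
      (centredBox d (ℓ (n + 2))).card * η) + δ * (centredBox d (ℓ (K + 1))).card := by
  have hxK : x ∈ centredBox d K := mem_centredBox_iff_norm_le.2 (by linarith [norm_nonneg x])
  have hKℓ : K ≤ ℓ (K + 1) := K.le_succ.trans ((h 0).le_scale _)
  have hKn4 : K ≤ ℓ (n + 2) / 4 := hKℓ.trans ((h 0).le_scale_div_four hKn)
  set p := boxCoeff V (centredBox d (ℓ (n + 2)))
    ((centredBox d (ℓ (n + 2) / 4) : Set (Lattice d)).indicator f) with hp
  have hfx : f x = ∑ j, p j * boxEigenfunction V _ j x := by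
    rw [hp, ← eq_sum_boxCoeff_mul _ (centredBox_subset_centredBox (by omega) hxK),
      Set.indicator_of_mem (Finset.mem_coe.2 (centredBox_subset_centredBox hKn4 hxK))]
  set T := localizedModes V m b J ℓ K n x η
  calc ‖f x‖ ≤ ∑ j, ‖p j‖ * ‖boxEigenfunction V _ j x‖ := by
        rw [hfx]
        exact (norm_sum_le _ _).trans_eq (by simp only [norm_mul])
    _ = ∑ j ∈ Tᶜ, ‖p j‖ * ‖boxEigenfunction V _ j x‖ +
          ∑ j ∈ T, ‖p j‖ * ‖boxEigenfunction V _ j x‖ := (Finset.sum_compl_add_sum _ _).symm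
    _ ≤ √(∑ j ∈ Tᶜ, ‖p j‖ ^ 2) * √(∑ j ∈ Tᶜ, ‖boxEigenfunction V _ j x‖ ^ 2) +
          δ * (centredBox d (ℓ (K + 1))).card :=
        add_le_add (Real.sum_mul_le_sqrt_mul_sqrt _ _ _) (sum_localizedModes_le hd hm h hKn hRn hδ
          hR (centredBox_subset_centredBox hKℓ hxK) hη)
    _ ≤ _ := by
        gcongr
        · exact Real.sqrt_le_iff.2 ⟨norm_nonneg _, sum_norm_sq_boxCoeff_indicator_le f _⟩
        · exact sum_compl_localizedModes_le hd hm.le h hx hη0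

lemma exists_forall_isApproxEigenfunction_norm_lt {f : Ell2 d}
    (hf : ∀ ψ, IsEigenfunction (schrodinger V) ψ → inner ℂ ψ f = 0) (A : ℝ) {c : ℝ} (hc : 0 < c)
    (C : ℕ) {δ : ℝ} (hδ : 0 < δ) :
    ∃ R, ∀ (E : ℝ) (u : Lattice d → ℂ), IsApproxEigenfunction V A c C R E u →
      ‖∑' y, conj (u y) * f y‖ < δ := by
  by_contra! hlarge
  obtain ⟨ψ, hψ, hψf⟩ := IsApproxEigenfunction.exists_isEigenfunction_inner_ne_zero hc hδ hlarge
  exact hψf (hf ψ hψ)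

lemma norm_apply_le_of_forall_inner_eq_zero (hd : 1 ≤ d) (hm : 0 < m)
    (h : ∀ E : ℝ, SparseAtAllScales V m b J E ℓ) {f : Ell2 d}
    (hf : ∀ ψ, IsEigenfunction (schrodinger V) ψ → inner ℂ ψ f = 0) (x : Lattice d) {ε : ℝ}
    (hε : 0 < ε) : ‖f x‖ ≤ ‖f‖ * √(2 * ε) + ε := by
  have hsummable : Summable fun k : ℕ => Real.exp (-(m * k)) :=
    (Real.summable_exp_nat_mul_iff.2 (neg_lt_zero.2 hm)).congr fun k => by ring_nf
  obtain ⟨K, htail, hxK⟩ := ((eventually_forall_sum_Icc_lt hsummable hε).and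
    (tendsto_natCast_atTop_atTop.eventually_ge_atTop (32 * ‖x‖))).exists
  have hcard : (0 : ℝ) < (centredBox d (ℓ (K + 1))).card := by
    have hzero : (0 : Lattice d) ∈ centredBox d (ℓ (K + 1)) :=
      mem_centredBox_iff_norm_le.2 (by rw [norm_zero]; positivity)
    exact_mod_cast Finset.card_pos.2 ⟨0, hzero⟩
  have hδ : 0 < ε / (centredBox d (ℓ (K + 1))).card := by positivity
  obtain ⟨R, hR⟩ := exists_forall_isApproxEigenfunction_norm_lt hf
    (Real.exp (m / 32 * ℓ (K + 1))) (by positivity : 0 < m / 32) (ℓ (K + 1)) hδ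
  have hlim : Tendsto (fun n => ℓ (n + 2)) atTop atTop :=
    tendsto_atTop_mono (fun n => (Nat.le_add_right n 2).trans ((h 0).le_scale (n + 2))) tendsto_id
  obtain ⟨n, hη, hRn, hKn⟩ := ((hlim.eventually (eventually_exp_lt_sqrt_mul d
    (by positivity : 0 < m / 192) (Real.exp_pos (-(m / 192 * ‖x‖))) hε)).and
      ((hlim.eventually (eventually_ge_atTop (4 * (R + 1)))).and (eventually_ge_atTop K))).exists
  have hη_le : (centredBox d (ℓ (n + 2))).card * (ε / (2 * (ℓ (n + 2) : ℝ) + 1) ^ d) ≤ ε := by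
    rw [mul_div_left_comm]
    refine mul_le_of_le_one_right hε.le ((div_le_one (by positivity)).2 ?_)
    exact card_Icc_le fun _ => by ring_nf; exact le_rfl
  calc ‖f x‖ ≤ _ := norm_apply_le_of_forall_isApproxEigenfunction hd hm h hKn hRn hδ.le hR hxK
        (by positivity) hη
    _ ≤ ‖f‖ * √(2 * ε) + ε := by
        rw [div_mul_cancel₀ _ hcard.ne']
        gcongr
        linarith [htail n]

theorem hasPurePointSpectrum_schrodinger (hd : 1 ≤ d) (hm : 0 < m)
    (h : ∀ E : ℝ, SparseAtAllScales V m b J E ℓ) : HasPurePointSpectrum (schrodinger V) := by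
  unfold HasPurePointSpectrum
  rw [Submodule.topologicalClosure_eq_top_iff, Submodule.eq_bot_iff]
  intro f hf
  rw [Submodule.mem_orthogonal] at hf
  refine lp.ext (funext fun x => norm_le_zero_iff.1 ?_)
  have hlim : Tendsto (fun ε : ℝ => ‖f‖ * √(2 * ε) + ε) (𝓝[>] 0) (𝓝 0) := by
    have hcont : Continuous fun ε : ℝ => ‖f‖ * √(2 * ε) + ε := by fun_prop
    simpa using (hcont.tendsto 0).mono_left nhdsWithin_le_nhds
  refine ge_of_tendsto hlim ?_
  filter_upwards [self_mem_nhdsWithin] with ε hε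
  exact norm_apply_le_of_forall_inner_eq_zero hd hm h
    (fun ψ hψ => hf ψ (Submodule.subset_span hψ)) x hε

end Completeness

end

end MSA

theorem proposition3 (d : ℕ) (hd : 1 ≤ d) (m b γ : ℝ) (J : ℕ)
    (hm : 0 < m) (hb0 : 0 < b) (hb1 : b < 1) (hγ : 2 - b < γ) (hJ : 1 ≤ J) :
    ∃ Lstar : ℕ, ∀ L₀ : ℕ, Lstar ≤ L₀ → ∀ V : MSA.Lattice d → ℝ,
      (∀ E : ℝ,
        (∀ k : ℕ,
          (∀ R : Finset (MSA.Lattice d), MSA.IsRectangle (MSA.scale γ L₀ (k + 2)) R →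
            MSA.IsSparse J
              (MSA.resonantRectangles V m b J E (MSA.scale γ L₀ k) (MSA.scale γ L₀ (k + 1))) R) ∧
          MSA.IsSparse 2
            (MSA.resonantRectangles V m b J E (MSA.scale γ L₀ k) (MSA.scale γ L₀ (k + 1)))
            (MSA.centredBox d (MSA.scale γ L₀ (k + 2)))) ∧
        (∀ R : Finset (MSA.Lattice d), MSA.IsRectangle (MSA.scale γ L₀ 1) R →
          MSA.IsSparse J (MSA.singularRectangles V m b E (MSA.scale γ L₀ 0)) R)) →
      MSA.HasPurePointSpectrum (MSA.schrodinger V) ∧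
      ∀ ψ : MSA.Ell2 d, MSA.IsEigenfunction (MSA.schrodinger V) ψ →
        ∃ C : ℝ, ∀ x : MSA.Lattice d, ‖ψ x‖ * Real.exp (m / 16 * ‖x‖) ≤ C := by
  obtain ⟨N, hN⟩ := Filter.eventually_atTop.1 (MSA.eventually_goodScales d J hm hb0 hb1 hγ)
  refine ⟨N, fun L₀ hL₀ V hV => ?_⟩
  have hNscale (k : ℕ) : N ≤ MSA.scale γ L₀ k := by
    induction k with
    | zero => exact hL₀
    | succ k ih => exact ih.trans (hN _ ih).le
  have hsparse (E : ℝ) : MSA.SparseAtAllScales V m b J E (MSA.scale γ L₀) :=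
    MSA.sparseAtAllScales hd hm.le (fun k => hN _ (hNscale k)) (fun k => ((hV E).1 k).1)
      (fun k => ((hV E).1 k).2) (hV E).2
  exact ⟨MSA.hasPurePointSpectrum_schrodinger hd hm hsparse,
    fun ψ hψ => MSA.exists_norm_mul_exp_le_of_isEigenfunction hd hm hsparse hψ⟩
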